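/- Let $R$ be a finite chain ring (a finite commutative ring with $1\neq 0$ whose ideals are totally ordered by inclusion), let $\pi$ generate its maximal ideal, let $q=|R/\langle\pi\rangle|$, and let $s$ be the least positive integer with $\pi^s=0$. An $s$-shape is a sequence $\mu=(\mu_1,\dots,\mu_s)$ of integers $0\le\mu_1\le\dots\le\mu_s$; put $\mu_0=0$. Write $\kappa\preceq\mu$ if $\kappa_i\le\mu_i$ for all $i$, add shapes componentwise, and identify an integer $t$ with the shape $(t,\dots,t)$. Let $R^\mu\subseteq R^{\mu_s}$ be the module of all tuples whose entries in positions $\mu_i+1,\dots,\mu_{i+1}$ lie in $\langle\pi^i\rangle$ ($0\le i<s$). A module has shape $\kappa$ if it is isomorphic to $R^\kappa$, and the shape of a matrix is the shape of its row span. Let $R^{n\times\mu}$ be the set of $n$-row matrices whose rows lie in $R^\mu$, and let $\mathcal T_\kappa(R^{n\times\mu})$, respectively $\mathcal T_\kappa(R^{n\times m})$, be the set of matrices of shape $\kappa$ in $R^{n\times\mu}$, respectively in $R^{n\times m}$. For $\kappa\preceq\mu$ put $$\begin{bmatrix}\mu\\ \kappa\end{bmatrix}=\prod_{i=1}^{s}q^{(\mu_i-\kappa_i)\kappa_{i-1}}\binom{\mu_i-\kappa_{i-1}}{\kappa_i-\kappa_{i-1}}_{q},\qquad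 \binom{m}{k}_q=\prod_{i=0}^{k-1}\frac{q^m-q^i}{q^k-q^i}$$ (this is the number of submodules of $R^\mu$ of shape $\kappa$). Theorem. Let $0\le n\le N$ be integers and let $\mu,\tau$ be $s$-shapes with $\tau\preceq N$ and $\tau\preceq\mu$. Consider the memoryless channel with input $X\in R^{n\times\mu}$ and output $Y=AX+Z\in R^{N\times\mu}$, where $A$ is uniform on $\mathcal T_n(R^{N\times n})$ (the full-column-rank matrices), $Z$ is uniform on $\mathcal T_\tau(R^{N\times\mu})$, and $X,A,Z$ are independent. Let $C=\max_{p_X}I(X;Y)$ be its capacity, with logarithms to the base $q$. Then: (a) $$C\le\log_q\sum_{\lambda\preceq N,\ \lambda\preceq n+\tau,\ \lambda\preceq\mu}\begin{bmatrix}\mu\\ \lambda\end{bmatrix}-\log_q|\mathcal T_\tau(R^{N\times\mu})|+\log_q\sum_{\tau'\preceq\tau}|\mathcal T_{\tau'}(R^{N\times\min\{n+\tau_s,N\}})|,$$ the sums being over $s$-shapes $\lambda$ and $\tau'$. (b) With $\xi_i=\min\{N,\,n+\tau_i,\,\lfloor\mu_i/2\rfloor\}$ for all $i$, $$C\le\sum_{i=1}^{s}(\mu_i-\xi_i)\xi_i+\sum_{i=1}^{s}(\min\{n+\tau_s,N\}-\mu_i)\tau_i+2s\log_q4+\log_q\binom{N+s}{s}+\log_q\binom{\tau_s+s}{s}-\log_q\prod_{i=0}^{\tau_s-1}(1-q^{i-N}).$$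 (c) In particular, if $\mu_i\ge 2N$ for all $i$ and $\tau=(t,\dots,t)$, then $$C\le\sum_{i=1}^{s}(\min\{n+t,N\}-t)(\mu_i-\min\{n+t,N\})+2s\log_q4+\log_q\binom{N+s}{s}+\log_q\binom{t+s}{s}-\log_q\prod_{i=0}^{t-1}(1-q^{i-N}).$$ -/

import Mathlib

noncomputable section

namespace MatrixChannel

/-! ### Discrete memoryless channels with finite alphabets -/

section Capacity

variable {α β : Type*} [Fintype α] [Fintype β]

/-- Shannon entropy of a distribution `p` on a finite set, with logarithms to the base `b`. -/
def entropy (b : ℝ) (p : α → ℝ) : ℝ :=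
  (∑ x, Real.negMulLog (p x)) / Real.log b

/-- The output distribution of the channel `W` (`W x y` is the probability of the output `y`
given the input `x`) for the input distribution `p`. -/
def outputLaw (W : α → β → ℝ) (p : α → ℝ) : β → ℝ :=
  fun y => ∑ x, p x * W x y

/-- The mutual information `I(X; Y) = H(Y) - H(Y | X)`, where `X` has the distribution `p` and
`Y` is the output of the channel `W` for the input `X`. -/
def mutualInfo (b : ℝ) (W : α → β → ℝ) (p : α → ℝ) : ℝ :=
  entropy b (outputLaw W p) - ∑ x, p x * entropy b (W x)

/-- The capacity of the channel `W`: the maximum of the mutual information over all the input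
distributions (see `capacity_isGreatest`). -/
def capacity (b : ℝ) (W : α → β → ℝ) : ℝ :=
  sSup (mutualInfo b W '' stdSimplex ℝ α)

theorem continuous_mutualInfo (b : ℝ) (W : α → β → ℝ) : Continuous (mutualInfo b W) := by
  unfold mutualInfo entropy outputLaw
  refine Continuous.sub (Continuous.div_const (continuous_finsetSum _ fun y _ => ?_) _) ?_
  · exact Real.continuous_negMulLog.comp (by fun_prop)
  · fun_prop

/-- The supremum in the definition of the capacity is a maximum. -/
theorem capacity_isGreatest [Nonempty α] (b : ℝ) (W : α → β → ℝ) :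
    IsGreatest (mutualInfo b W '' stdSimplex ℝ α) (capacity b W) := by
  classical
  refine ((isCompact_stdSimplex ℝ α).image (continuous_mutualInfo b W)).isGreatest_sSup ?_
  obtain ⟨a⟩ := ‹Nonempty α›
  exact Set.Nonempty.image _ ⟨_, single_mem_stdSimplex ℝ a⟩

end Capacity

/-! ### Finite chain rings and shapes -/

/-- `R` is a finite chain ring whose maximal ideal is generated by `π`, whose residue field has
`q` elements and whose chain length (the nilpotency index of `π`) is `s`. -/
structure IsFiniteChainRing (R : Type*) [CommRing R] (π : R) (q s : ℕ) : Prop where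
  nontrivial : Nontrivial R
  finite : Finite R
  chain : ∀ I J : Ideal R, I ≤ J ∨ J ≤ I
  maximal : (Ideal.span {π}).IsMaximal
  card_residue : Nat.card (R ⧸ Ideal.span {π}) = q
  length : IsLeast {k : ℕ | 0 < k ∧ π ^ k = 0} s

/-- The component `μ_i` of an `s`-shape in the numbering `μ_1 ≤ ⋯ ≤ μ_s`, with `μ_0 = 0`. An
`s`-shape is a monotone function `μ : Fin s → ℕ`, so that `μ_{i+1}` is `μ i` for `i : Fin s`. -/
def comp {s : ℕ} (μ : Fin s → ℕ) (i : ℕ) : ℕ :=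
  if h : 0 < i ∧ i ≤ s then μ ⟨i - 1, by omega⟩ else 0

open Classical in
/-- The finite set of all the `s`-shapes `κ` with `κ ⪯ μ`. -/
def subshapes {s : ℕ} (μ : Fin s → ℕ) : Finset (Fin s → ℕ) :=
  (Finset.Iic μ).filter fun κ => Monotone κ

/-- The Gaussian coefficient `∏_{i < k} (q ^ m - q ^ i) / (q ^ k - q ^ i)`. -/
def gaussCoeff (q m k : ℕ) : ℝ :=
  ∏ i ∈ Finset.range k, ((q : ℝ) ^ m - (q : ℝ) ^ i) / ((q : ℝ) ^ k - (q : ℝ) ^ i)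

/-- The number of submodules of shape `κ` of a module of shape `μ` over a chain ring with
residue field of size `q`:
`∏_{i=1}^s q ^ ((μ_i - κ_i) κ_{i-1}) [μ_i - κ_{i-1} choose κ_i - κ_{i-1}]_q`, for `κ ⪯ μ`. -/
def shapeCoeff (q : ℕ) {s : ℕ} (μ κ : Fin s → ℕ) : ℝ :=
  ∏ i : Fin s, (q : ℝ) ^ ((μ i - κ i) * comp κ i) *
    gaussCoeff q (μ i - comp κ i) (κ i - comp κ i)

/-! ### Modules and matrices over a finite chain ring -/

section Matrices

variable {R : Type*} [CommRing R]

/-- The module `R ^ μ` of all the tuples of length `μ_s` whose entries in the positions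
`μ_i + 1, …, μ_{i+1}` are multiples of `π ^ i`, for `0 ≤ i < s`. -/
def shapeModule (π : R) {s : ℕ} (μ : Fin s → ℕ) : Submodule R (Fin (comp μ s) → R) where
  carrier := {x | ∀ (i : ℕ) (j : Fin (comp μ s)), i < s → comp μ i ≤ j → (j : ℕ) < comp μ (i + 1) →
    x j ∈ Ideal.span {π ^ i}}
  add_mem' := fun hx hy i j hi h₁ h₂ => add_mem (hx i j hi h₁ h₂) (hy i j hi h₁ h₂)
  zero_mem' := fun _ _ _ _ _ => zero_mem _
  smul_mem' := fun c _ hx i j hi h₁ h₂ => Ideal.mul_mem_left _ c (hx i j hi h₁ h₂)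

/-- The `R`-module `M` has the shape `κ`: it is isomorphic to `R ^ κ`. -/
def HasShape (π : R) {s : ℕ} (M : Type*) [AddCommGroup M] [Module R M] (κ : Fin s → ℕ) : Prop :=
  Monotone κ ∧ Nonempty (M ≃ₗ[R] shapeModule π κ)

/-- The row span of a matrix. -/
def rowSpan {n m : ℕ} (A : Matrix (Fin n) (Fin m) R) : Submodule R (Fin m → R) :=
  Submodule.span R (Set.range A.row)

/-- `𝒯_κ(R ^ (n × m))`: the set of all the `n × m` matrices of shape `κ`, where the shape of a
matrix is the shape of its row span. -/
def matricesOfShape (π : R) (n m : ℕ) {s : ℕ} (κ : Fin s → ℕ) :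
    Set (Matrix (Fin n) (Fin m) R) :=
  {A | HasShape π (rowSpan A) κ}

/-- `R ^ (n × μ)`: the set of all the matrices with `n` rows, all of them in `R ^ μ`. -/
def rowMatrices (π : R) (n : ℕ) {s : ℕ} (μ : Fin s → ℕ) :
    Set (Matrix (Fin n) (Fin (comp μ s)) R) :=
  {X | ∀ i, X.row i ∈ shapeModule π μ}

/-- `𝒯_κ(R ^ (n × μ))`: the set of all the matrices of shape `κ` in `R ^ (n × μ)`. -/
def rowMatricesOfShape (π : R) (n : ℕ) {s : ℕ} (μ κ : Fin s → ℕ) :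
    Set (Matrix (Fin n) (Fin (comp μ s)) R) :=
  rowMatrices π n μ ∩ matricesOfShape π n (comp μ s) κ

instance [Finite R] (π : R) (n : ℕ) {s : ℕ} (μ : Fin s → ℕ) : Fintype (rowMatrices π n μ) :=
  Fintype.ofFinite _

/-- The transition probabilities of the channel `Y = A X + Z` with input `X` in `R ^ (n × μ)` and
output `Y` in `R ^ (N × μ)`, where `A` is uniform on `𝒯_n(R ^ (N × n))`, `Z` is uniform on
`𝒯_τ(R ^ (N × μ))`, and `A` and `Z` are independent of each other and of `X`: the fraction of
the pairs `(A, Z)` with `A X + Z = Y`. -/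
def mamc (π : R) (N n : ℕ) {s : ℕ} (μ τ : Fin s → ℕ) :
    rowMatrices π n μ → rowMatrices π N μ → ℝ :=
  fun X Y =>
    (Nat.card {p : matricesOfShape π N n (fun _ : Fin s => n) × rowMatricesOfShape π N μ τ //
        p.1.1 * X.1 + p.2.1 = Y.1} : ℝ) /
      ((Nat.card (matricesOfShape π N n (fun _ : Fin s => n)) : ℝ) *
        (Nat.card (rowMatricesOfShape π N μ τ) : ℝ))

end Matrices

end MatrixChannel

end

open MatrixChannel

/-! Information side. Row span is a statistic of the output. If the output charges only row spans in
a set `S`, then `H(Y)` is at most `log |S|` plus the mean logarithm of the size of the fiber through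
`Y`, the fiber being the set of outputs with the same row span. If each transition probability times
the size of its fiber is at most `K`, then `H(Y | X)` is at least the same mean minus `log K`. The
means cancel, so `I(X;Y) ≤ log |S| + log K` for every input law (`mutualInfo_le`).

The set `S`. The row span of `AX + Z` lies in `R^μ`, is generated by `N` elements, and lies in the
sum of a quotient of `R^n` and a module of shape `τ`. Hence its shape is bounded by `μ`, `N` and `n
+ τ`, and `shapeCoeff` counts the candidates.

The constant `K`. Matrices with equal row spans differ by an invertible left factor
(`exists_unit_mul_eq`), and such factors preserve the set of admissible `A`. Double counting pairs
`(Y', A)` therefore reduces the matter to counting, for one `A`, the `Y'` with a given row span `U`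
and `Y' - AX` of shape `τ` (`card_rowSpan_mul_card_le`). As `R` is self-injective, some linear map
into `R^m'`, with `m' = min (n + τ_s) N`, is injective on `U`. It sends `Y' - AX` to a matrix of
shape at most `τ` that determines `Y'` (`card_rowSpan_eq_le`).

Counting. A shape is read off from the sizes of the layers `M[π] ∩ π^a M`; these are monotone under
submodules and quotients and determine a finite module (`hasShape_iff`). Embeddings of `R^κ` are
counted one cyclic summand at a time, submodules are embeddings modulo automorphisms, and matrices
with a given row span are generating tuples, counted by Nakayama's lemma.

The explicit bounds follow from `q^(k(m-k)) ≤ gaussCoeff q m k ≤ 4 q^(k(m-k))`, a binomial bound on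
the number of shapes, and maximization of the quadratic exponents. -/

noncomputable section

namespace MatrixChannel

open Submodule

/-! ### The filtration of the socle by powers of `π`. -/

section Filtration

variable {R : Type*} [CommRing R]

/-- The elements of `π ^ a M` that are annihilated by `π`. -/
def powSocle (π : R) (M : Type*) [AddCommGroup M] [Module R M] (a : ℕ) : Submodule R M :=
  torsionBy R M π ⊓ LinearMap.range (LinearMap.lsmul R M (π ^ a))

theorem mem_powSocle {π : R} {M : Type*} [AddCommGroup M] [Module R M] {a : ℕ} {x : M} :
    x ∈ powSocle π M a ↔ π • x = 0 ∧ ∃ y : M, π ^ a • y = x := by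
  simp [powSocle, mem_torsionBy_iff]

theorem powSocle_antitone (π : R) (M : Type*) [AddCommGroup M] [Module R M] :
    Antitone (powSocle π M) := by
  intro a b hab x hx
  rw [mem_powSocle] at hx ⊢
  obtain ⟨h, y, rfl⟩ := hx
  exact ⟨h, π ^ (b - a) • y, by rw [smul_smul, ← pow_add, Nat.add_sub_cancel' hab]⟩

theorem card_inf_ker_mul_card_map {M M' : Type*} [AddCommGroup M] [Module R M] [AddCommGroup M']
    [Module R M'] (p : Submodule R M) (f : M →ₗ[R] M') :
    Nat.card (p ⊓ LinearMap.ker f : Submodule R M) * Nat.card (p.map f) = Nat.card p := by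
  have h := card_eq_card_quotient_mul_card (LinearMap.ker (f.domRestrict p))
  rw [Nat.card_congr (LinearMap.quotKerEquivRange (f.domRestrict p)).toEquiv,
    LinearMap.range_domRestrict] at h
  have e : Nat.card (LinearMap.ker (f.domRestrict p)) =
      Nat.card (p ⊓ LinearMap.ker f : Submodule R M) := by
    refine Nat.card_congr ⟨fun x => ⟨x.1.1, x.1.2, x.2⟩, fun x => ⟨⟨x.1, x.2.1⟩, x.2.2⟩, ?_, ?_⟩
    · intro x; rfl
    · intro x; rfl
  rw [h, e, mul_comm]

variable (π : R) (M : Type*) [AddCommGroup M] [Module R M]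

/-- Multiplication by `π ^ a` maps the larger torsion submodule onto the layer, and its kernel there
is the smaller one. -/
theorem card_torsionBy_pow_succ (a : ℕ) :
    Nat.card (torsionBy R M (π ^ (a + 1))) =
      Nat.card (torsionBy R M (π ^ a)) * Nat.card (powSocle π M a) := by
  rw [← card_inf_ker_mul_card_map (torsionBy R M (π ^ (a + 1))) (LinearMap.lsmul R M (π ^ a))]
  congr 2
  · have : torsionBy R M (π ^ (a + 1)) ⊓ LinearMap.ker (LinearMap.lsmul R M (π ^ a)) =
        torsionBy R M (π ^ a) :=
      inf_eq_right.2 (torsionBy_le_torsionBy_of_dvd _ _ (pow_dvd_pow _ (Nat.le_succ a)))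
    rw [this]
  · have : map (LinearMap.lsmul R M (π ^ a)) (torsionBy R M (π ^ (a + 1))) = powSocle π M a := by
      ext x
      simp only [mem_map, mem_torsionBy_iff, mem_powSocle, LinearMap.lsmul_apply]
      constructor
      · rintro ⟨y, hy, rfl⟩
        exact ⟨by rw [smul_smul, ← pow_succ', hy], y, rfl⟩
      · rintro ⟨h, y, rfl⟩
        exact ⟨y, by rw [pow_succ', mul_smul, h], rfl⟩
    rw [this]

theorem card_torsionBy_pow (a : ℕ) :
    Nat.card (torsionBy R M (π ^ a)) = ∏ b ∈ Finset.range a, Nat.card (powSocle π M b) := by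
  induction a with
  | zero => simp
  | succ a ih => rw [card_torsionBy_pow_succ, ih, Finset.prod_range_succ]

theorem card_eq_prod_card_powSocle {s : ℕ} (hs : π ^ s = 0) :
    Nat.card M = ∏ b ∈ Finset.range s, Nat.card (powSocle π M b) := by
  have : torsionBy R M (π ^ s) = ⊤ := by
    ext x; simp [hs]
  rw [← card_torsionBy_pow, this, Nat.card_congr (Submodule.topEquiv (R := R) (M := M)).toEquiv]

theorem card_torsionBy_mul_card_range (r : R) :
    Nat.card (torsionBy R M r) * Nat.card (LinearMap.range (LinearMap.lsmul R M r)) =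
      Nat.card M := by
  have h := card_inf_ker_mul_card_map (⊤ : Submodule R M) (LinearMap.lsmul R M r)
  rw [top_inf_eq, Submodule.map_top, Nat.card_congr (Submodule.topEquiv (R := R) (M := M)).toEquiv]
    at h
  exact h

theorem card_range_pow [Finite M] (a : ℕ) :
    Nat.card (LinearMap.range (LinearMap.lsmul R M (π ^ a))) =
      Nat.card (powSocle π M a) * Nat.card (LinearMap.range (LinearMap.lsmul R M (π ^ (a + 1)))) := by
  have h1 := card_torsionBy_mul_card_range M (π ^ a)
  have h2 := card_torsionBy_mul_card_range M (π ^ (a + 1))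
  rw [card_torsionBy_pow_succ, ← h1, mul_assoc] at h2
  exact (Nat.eq_of_mul_eq_mul_left Nat.card_pos h2).symm

variable {M}
variable {M' : Type*} [AddCommGroup M'] [Module R M']

theorem card_powSocle_le_of_injective [Finite M'] (f : M →ₗ[R] M') (hf : Function.Injective f)
    (a : ℕ) : Nat.card (powSocle π M a) ≤ Nat.card (powSocle π M' a) := by
  refine Nat.card_le_card_of_injective
    (fun x => ⟨f x.1, ?_⟩ : powSocle π M a → powSocle π M' a) ?_
  · obtain ⟨x, hx⟩ := x
    rw [mem_powSocle] at hx ⊢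
    obtain ⟨h, y, rfl⟩ := hx
    exact ⟨by rw [← map_smul, h, map_zero], f y, by rw [map_smul]⟩
  · intro x y h
    exact Subtype.ext (hf (congrArg Subtype.val h))

/-- A surjection need not map layers onto layers, so the argument counts instead: the size of a
layer is `|π^a M| / |π^(a+1) M|`, the submodules `π^a M` do map onto `π^a M'`, and their
intersections with `ker f` shrink as `a` grows. -/
theorem card_powSocle_le_of_surjective [Finite M] (f : M →ₗ[R] M')
    (hf : Function.Surjective f) (a : ℕ) :
    Nat.card (powSocle π M' a) ≤ Nat.card (powSocle π M a) := by
  have : Finite M' := Finite.of_surjective f hf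
  have hm : ∀ b, (LinearMap.range (LinearMap.lsmul R M (π ^ b))).map f =
      LinearMap.range (LinearMap.lsmul R M' (π ^ b)) := by
    intro b
    ext x
    simp only [mem_map, LinearMap.mem_range, LinearMap.lsmul_apply]
    constructor
    · rintro ⟨_, ⟨y, rfl⟩, rfl⟩
      exact ⟨f y, by rw [map_smul]⟩
    · rintro ⟨y, rfl⟩
      obtain ⟨z, rfl⟩ := hf y
      exact ⟨_, ⟨z, rfl⟩, by rw [map_smul]⟩
  have h1 := card_inf_ker_mul_card_map (LinearMap.range (LinearMap.lsmul R M (π ^ a))) f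
  have h2 := card_inf_ker_mul_card_map (LinearMap.range (LinearMap.lsmul R M (π ^ (a + 1)))) f
  rw [hm] at h1 h2
  rw [card_range_pow, card_range_pow π M, ← h2] at h1
  have hle : Nat.card (LinearMap.range (LinearMap.lsmul R M (π ^ (a + 1))) ⊓ LinearMap.ker f :
      Submodule R M) ≤ Nat.card (LinearMap.range (LinearMap.lsmul R M (π ^ a)) ⊓ LinearMap.ker f :
      Submodule R M) := by
    refine Nat.card_mono (Set.toFinite _) ?_
    rintro x ⟨⟨y, rfl⟩, hx⟩
    exact ⟨⟨π • y, by simp only [LinearMap.lsmul_apply, smul_smul, pow_succ]⟩, hx⟩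
  set K := Nat.card (LinearMap.range (LinearMap.lsmul R M (π ^ a)) ⊓ LinearMap.ker f :
      Submodule R M)
  set K' := Nat.card (LinearMap.range (LinearMap.lsmul R M (π ^ (a + 1))) ⊓ LinearMap.ker f :
      Submodule R M)
  set r := Nat.card (LinearMap.range (LinearMap.lsmul R M' (π ^ (a + 1))))
  have hr : 0 < r := Nat.card_pos
  have hK' : 0 < K' := Nat.card_pos
  have h3 : K * Nat.card (powSocle π M' a) = Nat.card (powSocle π M a) * K' :=
    Nat.eq_of_mul_eq_mul_right hr (by linarith)
  refine Nat.le_of_mul_le_mul_left ?_ hK'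
  calc K' * Nat.card (powSocle π M' a) ≤ K * Nat.card (powSocle π M' a) := by gcongr
    _ = _ := by rw [h3, mul_comm]

theorem card_powSocle_congr (e : M ≃ₗ[R] M') (a : ℕ) :
    Nat.card (powSocle π M a) = Nat.card (powSocle π M' a) := by
  refine Nat.card_congr (e.toEquiv.subtypeEquiv fun x => ?_)
  change x ∈ powSocle π M a ↔ e x ∈ powSocle π M' a
  rw [mem_powSocle, mem_powSocle, ← map_smul, e.map_eq_zero_iff]
  refine and_congr_right fun _ => ⟨?_, ?_⟩
  · rintro ⟨y, rfl⟩
    exact ⟨e y, by rw [map_smul]⟩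
  · rintro ⟨y, hy⟩
    exact ⟨e.symm y, by rw [← map_smul, hy, e.symm_apply_apply]⟩

variable (M M') in
theorem card_powSocle_prod (a : ℕ) :
    Nat.card (powSocle π (M × M') a) = Nat.card (powSocle π M a) * Nat.card (powSocle π M' a) := by
  have h : powSocle π (M × M') a = (powSocle π M a).prod (powSocle π M' a) := by
    ext ⟨x, y⟩
    simp only [mem_powSocle, Submodule.mem_prod, Prod.smul_mk, Prod.mk_eq_zero, Prod.exists,
      Prod.mk.injEq]
    constructor
    · rintro ⟨⟨h, h'⟩, u, v, hu, hv⟩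
      exact ⟨⟨h, u, hu⟩, h', v, hv⟩
    · rintro ⟨⟨h, u, hu⟩, h', v, hv⟩
      exact ⟨⟨h, h'⟩, u, v, hu, hv⟩
  rw [h, ← Nat.card_prod]
  exact Nat.card_congr Equiv.subtypeProdEquivProd

end Filtration

/-! ### Structure of finite chain rings: powers of `π`, the socle, self-injectivity. -/

namespace IsFiniteChainRing

variable {R : Type*} [CommRing R] {π : R} {q s : ℕ}

theorem isLocalRing (hR : IsFiniteChainRing R π q s) : IsLocalRing R := by
  refine IsLocalRing.of_unique_max_ideal ⟨Ideal.span {π}, hR.maximal, fun I hI => ?_⟩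
  rcases hR.chain I (Ideal.span {π}) with h | h
  · exact hI.eq_of_le hR.maximal.ne_top h
  · exact (hR.maximal.eq_of_le hI.ne_top h).symm

theorem pow_length (hR : IsFiniteChainRing R π q s) : π ^ s = 0 := hR.length.1.2

theorem length_pos (hR : IsFiniteChainRing R π q s) : 0 < s := hR.length.1.1

theorem pow_ne_zero (hR : IsFiniteChainRing R π q s) {i : ℕ} (hi : i < s) : π ^ i ≠ 0 := by
  intro h
  rcases Nat.eq_zero_or_pos i with rfl | hpos
  · have := hR.nontrivial
    simp at h
  · exact absurd (hR.length.2 ⟨hpos, h⟩) (not_le.2 hi)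

theorem isUnit_iff (hR : IsFiniteChainRing R π q s) {r : R} : IsUnit r ↔ ¬ π ∣ r := by
  have := hR.isLocalRing
  have hm : IsLocalRing.maximalIdeal R = Ideal.span {π} :=
    (IsLocalRing.eq_maximalIdeal hR.maximal).symm
  rw [← Ideal.mem_span_singleton, ← hm, IsLocalRing.mem_maximalIdeal, mem_nonunits_iff, not_not]

theorem exists_eq_unit_mul_pow (hR : IsFiniteChainRing R π q s) {r : R} (hr : r ≠ 0) :
    ∃ i < s, ∃ u : Rˣ, r = u * π ^ i := by
  classical
  have hex : ∃ i, ¬ π ^ (i + 1) ∣ r := by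
    refine ⟨s, fun h => hr ?_⟩
    rw [pow_succ, hR.pow_length, zero_mul] at h
    exact zero_dvd_iff.1 h
  have hmin : π ^ (Nat.find hex) ∣ r := by
    rcases h : Nat.find hex with _ | i
    · simp
    · have := Nat.find_min hex (m := i) (by omega)
      simpa using this
  obtain ⟨v, hv⟩ := hmin
  have hu : IsUnit v := by
    rw [hR.isUnit_iff]
    rintro ⟨w, rfl⟩
    exact Nat.find_spec hex ⟨w, hv.trans (by ring)⟩
  refine ⟨Nat.find hex, ?_, hu.unit, hv.trans (by rw [IsUnit.unit_spec, mul_comm])⟩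
  by_contra hle
  refine hr ?_
  rw [hv, ← Nat.add_sub_cancel' (not_lt.1 hle), pow_add, hR.pow_length, zero_mul, zero_mul]

theorem pow_mul_eq_zero_iff (hR : IsFiniteChainRing R π q s) {a : ℕ} (ha : a ≤ s) {r : R} :
    π ^ a * r = 0 ↔ π ^ (s - a) ∣ r := by
  constructor
  · intro h
    by_cases hr : r = 0
    · simp [hr]
    · obtain ⟨i, -, u, rfl⟩ := hR.exists_eq_unit_mul_pow hr
      rw [mul_left_comm, ← pow_add, Units.mul_right_eq_zero] at h
      have : s ≤ a + i := by
        by_contra hlt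
        exact hR.pow_ne_zero (not_le.1 hlt) h
      exact Dvd.dvd.mul_left (pow_dvd_pow _ (by omega)) _
  · rintro ⟨t, rfl⟩
    rw [← mul_assoc, ← pow_add, Nat.add_sub_cancel' ha, hR.pow_length, zero_mul]

theorem one_lt_residue [Finite R] (hR : IsFiniteChainRing R π q s) : 1 < q := by
  have := Ideal.Quotient.nontrivial_iff.2 hR.maximal.ne_top
  have hf : Finite (R ⧸ Ideal.span {π}) := Quotient.finite _
  rw [← hR.card_residue]
  exact Finite.one_lt_card

/-- Both this submodule and the residue field have size `|R| / |πR|`. -/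
theorem card_torsionBy_self [Finite R] (hR : IsFiniteChainRing R π q s) :
    Nat.card (torsionBy R R π) = q := by
  have h1 := card_torsionBy_mul_card_range R π
  have h2 := card_eq_card_quotient_mul_card (Ideal.span {π})
  have h3 : LinearMap.range (LinearMap.lsmul R R π) = Ideal.span {π} := by
    ext x
    simp [Ideal.mem_span_singleton', mul_comm]
  rw [hR.card_residue] at h2
  rw [h3, h2, mul_comm] at h1
  exact Nat.eq_of_mul_eq_mul_left Nat.card_pos h1

/-- The ideal `⟨π^(e+a)⟩` contains the socle `⟨π^(s-1)⟩` of `R` when `e + a < s`, and is zero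
otherwise. -/
theorem card_powSocle_span_pow [Finite R] (hR : IsFiniteChainRing R π q s) (e a : ℕ) :
    Nat.card (powSocle π (Ideal.span {π ^ e}) a) = if e + a < s then q else 1 := by
  split_ifs with h
  · rw [← hR.card_torsionBy_self]
    refine Nat.card_congr ⟨fun x => ⟨x.1.1, ?_⟩, fun x => ⟨⟨x.1, ?_⟩, ?_⟩, fun x => rfl,
      fun x => rfl⟩
    · have := (mem_powSocle.1 x.2).1
      rw [mem_torsionBy_iff]
      exact congrArg Subtype.val this
    · have hx := x.2
      rw [mem_torsionBy_iff, smul_eq_mul] at hx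
      have := (hR.pow_mul_eq_zero_iff (a := 1) (by omega)).1 (by simpa using hx)
      exact Ideal.mem_span_singleton.2 ((pow_dvd_pow _ (by omega)).trans this)
    · have hx := x.2
      rw [mem_torsionBy_iff, smul_eq_mul] at hx
      obtain ⟨t, ht⟩ := (hR.pow_mul_eq_zero_iff (a := 1) (by omega)).1 (by simpa using hx)
      refine mem_powSocle.2 ⟨Subtype.ext hx, ⟨⟨π ^ (s - 1 - a) * t, ?_⟩, Subtype.ext ?_⟩⟩
      · exact Ideal.mul_mem_right _ _ (Ideal.mem_span_singleton.2 (pow_dvd_pow _ (by omega)))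
      · simp only [ht, SetLike.mk_smul_mk, smul_eq_mul, ← mul_assoc, ← pow_add]
        congr 2
        omega
  · have : powSocle π (Ideal.span {π ^ e}) a = ⊥ := by
      rw [eq_bot_iff]
      intro x hx
      obtain ⟨-, ⟨y, hy⟩, rfl⟩ := mem_powSocle.1 hx
      obtain ⟨t, rfl⟩ := Ideal.mem_span_singleton.1 hy
      refine (Submodule.mem_bot R).2 (Subtype.ext ?_)
      simp only [SetLike.mk_smul_mk, smul_eq_mul, ← mul_assoc, ← pow_add, ZeroMemClass.coe_zero]
      rw [add_comm a e, ← Nat.add_sub_cancel' (not_lt.1 h), pow_add, hR.pow_length, zero_mul,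
        zero_mul]
    rw [this]
    simp

theorem card_eq_pow_of_isTorsionBy [Finite R] (hR : IsFiniteChainRing R π q s)
    (M : Type*) [AddCommGroup M] [Module R M] [Finite M] (h : Module.IsTorsionBy R M π) :
    ∃ k, Nat.card M = q ^ k := by
  have hmax := hR.maximal
  let _ := Ideal.Quotient.field (Ideal.span {π})
  have hs : Module.IsTorsionBySet R M (Ideal.span {π}) :=
    (Module.isTorsionBySet_span_singleton_iff π).2 h
  let _ := hs.module
  have hf : Finite (R ⧸ Ideal.span {π}) := Quotient.finite _
  let _ := Fintype.ofFinite (R ⧸ Ideal.span {π})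
  let _ := Fintype.ofFinite M
  refine ⟨Module.finrank (R ⧸ Ideal.span {π}) M, ?_⟩
  rw [← hR.card_residue, Nat.card_eq_fintype_card, Nat.card_eq_fintype_card]
  exact Module.card_eq_pow_finrank

/-- A chain ring is injective as a module over itself. -/
theorem baer (hR : IsFiniteChainRing R π q s) : Module.Baer R R := by
  intro I g
  by_cases hI : I = ⊥
  · subst hI
    refine ⟨0, fun x hx => ?_⟩
    have : (⟨x, hx⟩ : (⊥ : Ideal R)) = 0 := Subtype.ext ((Submodule.mem_bot R).1 hx)
    rw [this, map_zero, LinearMap.zero_apply]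
  classical
  -- With the least such exponent `i`, the ideal is `⟨π^i⟩`. Its generator is killed by `π^(s-i)`,
  -- hence so is its image, which is then `π^i z`; multiplication by `z` extends `g`.
  have hex : ∃ i, π ^ i ∈ I := ⟨s, by rw [hR.pow_length]; exact zero_mem _⟩
  have hmin : ∀ x ∈ I, π ^ Nat.find hex ∣ x := by
    intro x hx
    by_cases hx0 : x = 0
    · simp [hx0]
    obtain ⟨i, -, u, rfl⟩ := hR.exists_eq_unit_mul_pow hx0
    refine Dvd.dvd.mul_left (pow_dvd_pow _ (Nat.find_min' hex ?_)) _
    have := I.mul_mem_left (↑u⁻¹ : R) hx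
    simpa using this
  have his : Nat.find hex ≤ s := Nat.find_min' hex (by rw [hR.pow_length]; exact zero_mem _)
  set i := Nat.find hex with hi
  have hiI : π ^ i ∈ I := Nat.find_spec hex
  obtain ⟨z, hz⟩ : π ^ i ∣ g ⟨π ^ i, hiI⟩ := by
    have h0 : π ^ (s - i) * g ⟨π ^ i, hiI⟩ = 0 := by
      rw [← smul_eq_mul, ← map_smul]
      convert map_zero g
      refine Subtype.ext ?_
      simp only [SetLike.mk_smul_mk, smul_eq_mul, ← pow_add, ZeroMemClass.coe_zero]
      rw [Nat.sub_add_cancel his, hR.pow_length]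
    have := (hR.pow_mul_eq_zero_iff (a := s - i) (by omega)).1 h0
    rwa [Nat.sub_sub_self his] at this
  refine ⟨LinearMap.mulRight R z, fun x hx => ?_⟩
  obtain ⟨t, rfl⟩ := hmin x hx
  have : (⟨π ^ i * t, hx⟩ : I) = t • ⟨π ^ i, hiI⟩ := Subtype.ext (by simp [mul_comm])
  rw [this, map_smul, hz, LinearMap.mulRight_apply, smul_eq_mul]
  ring

end IsFiniteChainRing

/-! ### Direct sums of the ideals `⟨π^e⟩`. -/

section PowModule

variable {R : Type*} [CommRing R]

/-- The module of all the tuples of length `k` whose entry in position `j` is a multiple of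
`π ^ e j`. -/
def powModule (π : R) (e : ℕ → ℕ) (k : ℕ) : Submodule R (Fin k → R) :=
  Submodule.pi Set.univ fun j => Ideal.span {π ^ e j}

theorem mem_powModule {π : R} {e : ℕ → ℕ} {k : ℕ} {x : Fin k → R} :
    x ∈ powModule π e k ↔ ∀ j : Fin k, π ^ e j ∣ x j := by
  simp [powModule, Ideal.mem_span_singleton]

/-- Splitting off the last coordinate. -/
def powModuleSucc (π : R) (e : ℕ → ℕ) (k : ℕ) :
    powModule π e (k + 1) ≃ₗ[R] powModule π e k × Ideal.span {π ^ e k} where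
  toFun x := (⟨fun j => x.1 j.castSucc, mem_powModule.2 fun j => by
      simpa using mem_powModule.1 x.2 j.castSucc⟩,
    ⟨x.1 (Fin.last k), Ideal.mem_span_singleton.2 (by simpa using mem_powModule.1 x.2 (Fin.last k))⟩)
  invFun x := ⟨Fin.snoc (α := fun _ => R) x.1.1 x.2.1, mem_powModule.2 fun j => by
    refine Fin.lastCases ?_ (fun j => ?_) j
    · simpa using Ideal.mem_span_singleton.1 x.2.2
    · simpa using mem_powModule.1 x.1.2 j⟩
  map_add' _ _ := rfl
  map_smul' _ _ := rfl
  left_inv x := by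
    refine Subtype.ext (funext fun j => ?_)
    refine Fin.lastCases ?_ (fun j => ?_) j <;> simp
  right_inv x := by
    refine Prod.ext (Subtype.ext (funext fun j => ?_)) (Subtype.ext ?_) <;> simp

variable {π : R} {q s : ℕ}

/-- Because the exponents increase, the summands before position `k` are at least as long as the one
to be added there, so their socle is divisible by `π^(s-1-e k)`. This is what `card_extension`
needs. -/
theorem torsionBy_powModule_le (hR : IsFiniteChainRing R π q s) {e : ℕ → ℕ} (he : Monotone e)
    (k : ℕ) (hk : e k < s) :
    torsionBy R (powModule π e k) π ≤ powSocle π (powModule π e k) (s - 1 - e k) := by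
  intro x hx
  rw [mem_torsionBy_iff] at hx
  refine mem_powSocle.2 ⟨hx, ?_⟩
  have hx' : ∀ j, ∃ t, x.1 j = π ^ (s - 1) * t := by
    intro j
    have hj : π * x.1 j = 0 := congrFun (congrArg Subtype.val hx) j
    exact (hR.pow_mul_eq_zero_iff (a := 1) (by omega)).1 (by simpa using hj)
  choose t ht using hx'
  refine ⟨⟨fun j => π ^ e k * t j, mem_powModule.2 fun j => ?_⟩, Subtype.ext (funext fun j => ?_)⟩
  · exact Dvd.dvd.mul_right (pow_dvd_pow _ (he j.2.le)) _
  · simp only [SetLike.mk_smul_mk, Pi.smul_apply, smul_eq_mul, ← mul_assoc, ← pow_add, ht]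
    congr 2
    omega

variable [Finite R]

theorem card_powSocle_powModule (hR : IsFiniteChainRing R π q s) (e : ℕ → ℕ) (k a : ℕ) :
    Nat.card (powSocle π (powModule π e k) a) =
      ∏ j ∈ Finset.range k, if e j + a < s then q else 1 := by
  induction k with
  | zero => simp
  | succ k ih =>
    rw [card_powSocle_congr π (powModuleSucc π e k), card_powSocle_prod, ih,
      hR.card_powSocle_span_pow, Finset.prod_range_succ]

theorem card_torsionBy_powModule (hR : IsFiniteChainRing R π q s) (e : ℕ → ℕ) (k : ℕ)
    (he : ∀ j < k, e j < s) :
    Nat.card (torsionBy R (powModule π e k) π) = q ^ k := by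
  have h := card_torsionBy_pow_succ π (powModule π e k) 0
  simp only [zero_add, pow_one, pow_zero, torsionBy_one, card_powSocle_powModule hR] at h
  rw [h]
  simp only [Nat.card_unique, add_zero, one_mul]
  rw [Finset.prod_congr rfl fun j hj => if_pos (he j (Finset.mem_range.1 hj))]
  simp

end PowModule

/-! ### Counting embeddings, one cyclic summand at a time. -/

section CountInjective

variable {R : Type*} [CommRing R] {π : R} {q s : ℕ}
  {P M : Type*} [AddCommGroup P] [Module R P] [AddCommGroup M] [Module R M]

/-- A linear map from `⟨π ^ e⟩` is determined by the image of `π ^ e`, which can be any element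
annihilated by `π ^ (s - e)`. -/
theorem exists_span_pow_hom (hR : IsFiniteChainRing R π q s) {e : ℕ} (he : e ≤ s) (x : M)
    (hx : π ^ (s - e) • x = 0) :
    ∃ g : Ideal.span {π ^ e} →ₗ[R] M, g ⟨π ^ e, Ideal.mem_span_singleton_self _⟩ = x := by
  have hle : Ideal.torsionOf R R (π ^ e) ≤ LinearMap.ker (LinearMap.toSpanSingleton R M x) := by
    intro r hr
    rw [Ideal.mem_torsionOf_iff, smul_eq_mul, mul_comm, hR.pow_mul_eq_zero_iff he] at hr
    obtain ⟨t, rfl⟩ := hr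
    rw [LinearMap.mem_ker, LinearMap.toSpanSingleton_apply, mul_comm, mul_smul, hx, smul_zero]
  let E := Ideal.quotTorsionOfEquivSpanSingleton R R (π ^ e)
  refine ⟨(Submodule.liftQ _ _ hle).comp E.symm.toLinearMap, ?_⟩
  have h1 : E (Submodule.Quotient.mk 1) = ⟨π ^ e, Ideal.mem_span_singleton_self _⟩ := by
    rw [Ideal.quotTorsionOfEquivSpanSingleton_apply_mk]
    exact one_smul R _
  rw [← h1, LinearMap.comp_apply, LinearEquiv.coe_coe, E.symm_apply_apply, Submodule.liftQ_apply,
    LinearMap.toSpanSingleton_apply, one_smul]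

theorem span_pow_hom_ext {e : ℕ} {g g' : Ideal.span {π ^ e} →ₗ[R] M}
    (h : g ⟨π ^ e, Ideal.mem_span_singleton_self _⟩ = g' ⟨π ^ e, Ideal.mem_span_singleton_self _⟩) :
    g = g' := by
  ext ⟨x, hx⟩
  obtain ⟨t, rfl⟩ := Ideal.mem_span_singleton.1 hx
  have : (⟨π ^ e * t, hx⟩ : Ideal.span {π ^ e}) =
      t • ⟨π ^ e, Ideal.mem_span_singleton_self _⟩ := Subtype.ext (by simp [mul_comm])
  rw [this, map_smul, map_smul, h]

/-- Any kernel element with nonzero second component has a multiple whose second component is the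
socle generator `π^(s-1)` of `⟨π^e⟩`, so only the image of that generator has to avoid `range f`. -/
theorem coprod_injective_iff (hR : IsFiniteChainRing R π q s) {e : ℕ} (he : e < s)
    (f : P →ₗ[R] M) (g : Ideal.span {π ^ e} →ₗ[R] M) :
    Function.Injective (f.coprod g) ↔ Function.Injective f ∧
      π ^ (s - 1 - e) • g ⟨π ^ e, Ideal.mem_span_singleton_self _⟩ ∉ LinearMap.range f := by
  constructor
  · intro h
    refine ⟨fun x y hxy => ?_, ?_⟩
    · have := @h (x, 0) (y, 0) (by simpa using hxy)
      exact congrArg Prod.fst this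
    · rintro ⟨p, hp⟩
      rw [← map_smul] at hp
      have := @h (p, 0) (0, π ^ (s - 1 - e) • ⟨π ^ e, Ideal.mem_span_singleton_self _⟩)
        (by simpa using hp)
      have h2 := congrArg Subtype.val (congrArg Prod.snd this)
      simp only [ZeroMemClass.coe_zero, SetLike.mk_smul_mk, smul_eq_mul, ← pow_add] at h2
      exact hR.pow_ne_zero (i := s - 1 - e + e) (by omega) h2.symm
  · rintro ⟨hf, hg⟩
    rw [← LinearMap.ker_eq_bot, LinearMap.ker_eq_bot']
    rintro ⟨p, ⟨r, hr⟩⟩ h0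
    rw [LinearMap.coprod_apply] at h0
    by_cases hr0 : r = 0
    · subst hr0
      have hz : (⟨0, hr⟩ : Ideal.span {π ^ e}) = 0 := rfl
      rw [hz, map_zero, add_zero] at h0
      have : p = 0 := hf (by rw [h0, map_zero])
      rw [this, hz]
      rfl
    · exfalso
      refine hg ?_
      obtain ⟨i, hi, u, rfl⟩ := hR.exists_eq_unit_mul_pow hr0
      have hei : (⟨π ^ (s - 1 - e) * π ^ e, Ideal.mul_mem_left _ _
          (Ideal.mem_span_singleton_self _)⟩ : Ideal.span {π ^ e}) =
          ((↑u⁻¹ : R) * π ^ (s - 1 - i)) • ⟨u * π ^ i, hr⟩ := by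
        refine Subtype.ext ?_
        simp only [SetLike.mk_smul_mk, smul_eq_mul]
        have : (↑u⁻¹ : R) * π ^ (s - 1 - i) * (u * π ^ i) =
            ((↑u⁻¹ : R) * u) * (π ^ (s - 1 - i) * π ^ i) := by ring
        rw [this, Units.inv_mul, one_mul, ← pow_add, ← pow_add]
        congr 1
        omega
      have hg' : π ^ (s - 1 - e) • g ⟨π ^ e, Ideal.mem_span_singleton_self _⟩ =
          ((↑u⁻¹ : R) * π ^ (s - 1 - i)) • g ⟨u * π ^ i, hr⟩ := by
        rw [← map_smul, ← map_smul, ← hei]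
        rfl
      rw [hg', eq_neg_of_add_eq_zero_right h0, ← map_neg, ← map_smul]
      exact LinearMap.mem_range_self _ _

variable [Finite M]

/-- The elements to be discarded from `M[π^(a+1)]` have `π^a x` in `range f`. By `hP`,
multiplication by `π^a` maps them onto `f(P[π])`, with kernel `M[π^a]`; all of `M[π^(a+1)]` maps
onto the layer with the same kernel. -/
theorem card_extension {a : ℕ}
    (hP : torsionBy R P π ≤ powSocle π P a) (f : P →ₗ[R] M) (hf : Function.Injective f) :
    Nat.card {x : M // π ^ (a + 1) • x = 0 ∧ π ^ a • x ∉ LinearMap.range f} =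
      (Nat.card (powSocle π M a) - Nat.card (torsionBy R P π)) *
        Nat.card (torsionBy R M (π ^ a)) := by
  set p : Submodule R M := torsionBy R M (π ^ (a + 1)) ⊓
    (LinearMap.range f).comap (LinearMap.lsmul R M (π ^ a)) with hp
  have h1 := card_inf_ker_mul_card_map p (LinearMap.lsmul R M (π ^ a))
  have hker : p ⊓ LinearMap.ker (LinearMap.lsmul R M (π ^ a)) = torsionBy R M (π ^ a) := by
    refine inf_eq_right.2 fun x hx => ⟨torsionBy_le_torsionBy_of_dvd _ _
      (pow_dvd_pow _ (Nat.le_succ a)) hx, ?_⟩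
    rw [SetLike.mem_coe, Submodule.mem_comap, LinearMap.lsmul_apply, (mem_torsionBy_iff _ _).1 hx]
    exact zero_mem _
  have hmap : p.map (LinearMap.lsmul R M (π ^ a)) = (torsionBy R P π).map f := by
    ext y
    simp only [hp, Submodule.mem_map, Submodule.mem_inf, mem_torsionBy_iff, Submodule.mem_comap,
      LinearMap.lsmul_apply, LinearMap.mem_range]
    constructor
    · rintro ⟨x, ⟨hx, z, hz⟩, rfl⟩
      refine ⟨z, hf ?_, hz⟩
      rw [map_smul, hz, smul_smul, ← pow_succ', hx, map_zero]
    · rintro ⟨z, hz, rfl⟩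
      obtain ⟨w, rfl⟩ := (mem_powSocle.1 (hP ((mem_torsionBy_iff _ _).2 hz))).2
      refine ⟨f w, ⟨?_, π ^ a • w, map_smul _ _ _⟩, (map_smul _ _ _).symm⟩
      rw [pow_succ', mul_smul, ← map_smul, ← map_smul, hz, map_zero]
  rw [hker, hmap, Nat.card_congr (Submodule.equivMapOfInjective f hf _).symm.toEquiv] at h1
  have h2 := card_torsionBy_pow_succ π M a
  have hsplit : Nat.card (torsionBy R M (π ^ (a + 1))) = Nat.card p +
      Nat.card {x : M // π ^ (a + 1) • x = 0 ∧ π ^ a • x ∉ LinearMap.range f} := by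
    have h3 := Set.ncard_sdiff_add_ncard_of_subset (s := (p : Set M))
      (t := (torsionBy R M (π ^ (a + 1)) : Set M)) (fun x hx => hx.1)
    rw [Set.ncard_def, Set.ncard_def] at h3
    rw [add_comm (Nat.card p)]
    refine h3.symm.trans (congrArg (· + _) ?_)
    refine Nat.card_congr (Equiv.subtypeEquivRight fun x => ?_)
    simp only [hp, Set.mem_sdiff, SetLike.mem_coe, mem_torsionBy_iff, Submodule.mem_inf,
      Submodule.mem_comap, LinearMap.lsmul_apply]
    tauto
  rw [Nat.sub_mul, mul_comm (Nat.card (torsionBy R P π)), h1, mul_comm, ← h2, hsplit]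
  omega

variable [Finite P]

theorem card_injective_prod (hR : IsFiniteChainRing R π q s) {e : ℕ} (he : e < s)
    (hP : torsionBy R P π ≤ powSocle π P (s - 1 - e)) :
    Nat.card {f : P × Ideal.span {π ^ e} →ₗ[R] M // Function.Injective f} =
      Nat.card {f : P →ₗ[R] M // Function.Injective f} *
      ((Nat.card (powSocle π M (s - 1 - e)) - Nat.card (torsionBy R P π)) *
        Nat.card (torsionBy R M (π ^ (s - 1 - e)))) := by
  classical
  have hes : s - e = s - 1 - e + 1 := by omega
  let ι : Ideal.span {π ^ e} := ⟨π ^ e, Ideal.mem_span_singleton_self _⟩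
  have hι : π ^ (s - 1 - e + 1) • ι = 0 := by
    refine Subtype.ext ?_
    simp only [ι, SetLike.mk_smul_mk, smul_eq_mul, ← pow_add, ZeroMemClass.coe_zero]
    rw [← hes, Nat.sub_add_cancel he.le, hR.pow_length]
  have E : {f : P × Ideal.span {π ^ e} →ₗ[R] M // Function.Injective f} ≃
      Σ f : {f : P →ₗ[R] M // Function.Injective f},
        {x : M // π ^ (s - 1 - e + 1) • x = 0 ∧ π ^ (s - 1 - e) • x ∉ LinearMap.range f.1} := by
    refine Equiv.ofBijective (fun F => ⟨⟨F.1.comp (LinearMap.inl R P _), fun x y h => ?_⟩,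
      ⟨F.1 (0, ι), ?_, ?_⟩⟩) ⟨?_, ?_⟩
    · exact congrArg Prod.fst (@F.2 (x, 0) (y, 0) h)
    · rw [← map_smul, Prod.smul_mk, hι, smul_zero]
      exact map_zero _
    · have hF : F.1 = (F.1.comp (LinearMap.inl R P _)).coprod (F.1.comp (LinearMap.inr R P _)) :=
        (LinearMap.coprod_comp_inl_inr F.1).symm
      exact ((coprod_injective_iff hR he _ _).1 (hF ▸ F.2)).2
    · rintro ⟨F, hF⟩ ⟨G, hG⟩ h
      obtain ⟨h1, h2⟩ := Sigma.mk.inj h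
      have h1 := congrArg Subtype.val h1
      dsimp only at h1
      refine Subtype.ext (LinearMap.prod_ext h1 (span_pow_hom_ext ?_))
      -- The second components of the two pairs live in subtypes that depend on the first
      -- components, so their equality is heterogeneous.
      have h3 : ∀ p p' : M → Prop, p = p' → ∀ (x : {x // p x}) (y : {x // p' x}), x ≍ y →
          x.1 = y.1 := by
        rintro p _ rfl x y h
        rw [eq_of_heq h]
      exact h3 _ _ (by simp only [h1]) _ _ h2
    · rintro ⟨⟨f, hf⟩, x, hx, hx'⟩
      obtain ⟨g, rfl⟩ := exists_span_pow_hom hR he.le x (hes ▸ hx)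
      refine ⟨⟨f.coprod g, (coprod_injective_iff hR he f g).2 ⟨hf, hx'⟩⟩, ?_⟩
      have h1 : (f.coprod g).comp (LinearMap.inl R P _) = f := LinearMap.coprod_inl f g
      have h2 : f.coprod g (0, ι) = g ι := by simp
      have h3 : ∀ (f' : P →ₗ[R] M) (hf' : Function.Injective f') (x' : M)
          (hx' : π ^ (s - 1 - e + 1) • x' = 0 ∧ π ^ (s - 1 - e) • x' ∉ LinearMap.range f')
          (hx : π ^ (s - 1 - e + 1) • g ι = 0 ∧ π ^ (s - 1 - e) • g ι ∉ LinearMap.range f),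
          f' = f → x' = g ι →
          (⟨⟨f', hf'⟩, ⟨x', hx'⟩⟩ : Σ f : {f : P →ₗ[R] M // Function.Injective f},
          {x : M // π ^ (s - 1 - e + 1) • x = 0 ∧ π ^ (s - 1 - e) • x ∉ LinearMap.range f.1}) =
          ⟨⟨f, hf⟩, ⟨g ι, hx⟩⟩ := by
        rintro _ _ _ _ _ rfl rfl
        rfl
      exact h3 _ _ _ _ _ h1 h2
  have hfin : Finite (P →ₗ[R] M) := Finite.of_injective _ DFunLike.coe_injective
  let _ : Fintype {f : P →ₗ[R] M // Function.Injective f} := Fintype.ofFinite _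
  rw [Nat.card_congr E, Nat.card_sigma, Finset.sum_congr rfl fun f _ =>
    card_extension hP f.1 f.2, Finset.sum_const, smul_eq_mul, Finset.card_univ,
    ← Nat.card_eq_fintype_card]

variable [Finite R]

theorem card_injective_powModule (hR : IsFiniteChainRing R π q s) {e : ℕ → ℕ} (he : Monotone e)
    (k : ℕ) (hk : ∀ j < k, e j < s) :
    Nat.card {f : powModule π e k →ₗ[R] M // Function.Injective f} =
      ∏ j ∈ Finset.range k, ((Nat.card (powSocle π M (s - 1 - e j)) - q ^ j) *
        Nat.card (torsionBy R M (π ^ (s - 1 - e j)))) := by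
  induction k with
  | zero =>
    rw [Finset.prod_range_zero, Nat.card_eq_one_iff_unique]
    refine ⟨⟨fun f g => Subtype.ext (LinearMap.ext fun x => ?_)⟩, ⟨0, fun x y _ => ?_⟩⟩
    · rw [Subsingleton.elim x 0, map_zero, map_zero]
    · exact Subsingleton.elim x y
  | succ k ih =>
    have E : {f : powModule π e (k + 1) →ₗ[R] M // Function.Injective f} ≃
        {f : powModule π e k × Ideal.span {π ^ e k} →ₗ[R] M // Function.Injective f} :=
      ((powModuleSucc π e k).arrowCongr (LinearEquiv.refl R M)).toEquiv.subtypeEquiv fun f => by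
        change Function.Injective f ↔ Function.Injective (f ∘ (powModuleSucc π e k).symm)
        exact ((powModuleSucc π e k).symm.toEquiv.injective_comp f).symm
    rw [Nat.card_congr E, card_injective_prod hR (hk k (Nat.lt_succ_self k))
      (torsionBy_powModule_le hR he k (hk k (Nat.lt_succ_self k))),
      ih fun j hj => hk j (by omega), Finset.prod_range_succ,
      card_torsionBy_powModule hR e k fun j hj => hk j (by omega)]

end CountInjective

/-! ### Combinatorics of shapes. -/

section Shapes

variable {s : ℕ}

theorem comp_zero (κ : Fin s → ℕ) : comp κ 0 = 0 := by simp [comp]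

theorem comp_succ (κ : Fin s → ℕ) (i : Fin s) : comp κ (i + 1) = κ i := by
  have := i.2
  simp [comp]

theorem comp_le_comp_succ {κ : Fin s → ℕ} (hκ : Monotone κ) {i : ℕ} (hi : i < s) :
    comp κ i ≤ comp κ (i + 1) := by
  rcases i with _ | i
  · simp [comp_zero]
  · rw [comp_succ κ ⟨i, by omega⟩, comp_succ κ ⟨i + 1, hi⟩]
    exact hκ (by simp)

theorem comp_le {κ : Fin s → ℕ} (hκ : Monotone κ) (i : Fin s) : comp κ i ≤ κ i :=
  (comp_le_comp_succ hκ i.2).trans_eq (comp_succ κ i)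

theorem le_comp {κ : Fin s → ℕ} (hκ : Monotone κ) (i : Fin s) : κ i ≤ comp κ s := by
  have hi := i.2
  obtain ⟨m, rfl⟩ : ∃ m, s = m + 1 := ⟨s - 1, by omega⟩
  have := comp_succ κ (Fin.last m)
  simp only [Fin.val_last] at this
  rw [this]
  exact hκ (Fin.le_last i)

theorem comp_le_of_forall_le {κ : Fin s → ℕ} {m : ℕ} (h : ∀ i, κ i ≤ m) (i : ℕ) :
    comp κ i ≤ m := by
  unfold comp
  split_ifs
  · exact h _
  · exact Nat.zero_le _

/-- The number of the parts of `κ` that are at most `j`. -/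
def partIndex (κ : Fin s → ℕ) (j : ℕ) : ℕ :=
  (Finset.univ.filter fun i => κ i ≤ j).card

theorem partIndex_monotone (κ : Fin s → ℕ) : Monotone (partIndex κ) := fun j k h =>
  Finset.card_le_card fun i hi => by
    simp only [Finset.mem_filter, Finset.mem_univ, true_and] at hi ⊢
    exact hi.trans h

/-- The indices of the parts that are at most `j` form an initial segment. Thus `partIndex κ j` is
the exponent of `π` required at the zero-based position `j` of `R^κ`. -/
theorem lt_partIndex_iff {κ : Fin s → ℕ} (hκ : Monotone κ) (i : Fin s) (j : ℕ) :
    (i : ℕ) < partIndex κ j ↔ κ i ≤ j := by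
  constructor
  · intro h
    by_contra hlt
    have : (Finset.univ.filter fun i => κ i ≤ j) ⊆ Finset.Iio i := by
      intro l hl
      simp only [Finset.mem_filter, Finset.mem_univ, true_and, Finset.mem_Iio] at hl ⊢
      by_contra hle
      exact hlt ((hκ (not_lt.1 hle)).trans hl)
    have := Finset.card_le_card this
    rw [Fin.card_Iio] at this
    unfold partIndex at h
    omega
  · intro h
    have : Finset.Iic i ⊆ (Finset.univ.filter fun i => κ i ≤ j) := by
      intro l hl
      simp only [Finset.mem_filter, Finset.mem_univ, true_and, Finset.mem_Iic] at hl ⊢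
      exact (hκ hl).trans h
    have := Finset.card_le_card this
    rw [Fin.card_Iic] at this
    exact this

theorem partIndex_le (κ : Fin s → ℕ) (j : ℕ) : partIndex κ j ≤ s :=
  (Finset.card_le_univ _).trans_eq (Fintype.card_fin s)

theorem partIndex_eq {κ : Fin s → ℕ} (hκ : Monotone κ) {i j : ℕ} (hi : i < s)
    (h₁ : comp κ i ≤ j) (h₂ : j < comp κ (i + 1)) : partIndex κ j = i := by
  refine le_antisymm ?_ ?_
  · rw [comp_succ κ ⟨i, hi⟩] at h₂
    by_contra h
    exact absurd ((lt_partIndex_iff hκ ⟨i, hi⟩ j).1 (not_le.1 h)) (not_le.2 h₂)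
  · rcases i with _ | i
    · exact Nat.zero_le _
    · rw [comp_succ κ ⟨i, by omega⟩] at h₁
      exact (lt_partIndex_iff hκ ⟨i, by omega⟩ j).2 h₁

theorem comp_partIndex_le {κ : Fin s → ℕ} (hκ : Monotone κ) (j : ℕ) :
    comp κ (partIndex κ j) ≤ j := by
  rcases h : partIndex κ j with _ | i
  · simp [comp_zero]
  · have hi := partIndex_le κ j
    rw [comp_succ κ ⟨i, by omega⟩]
    exact (lt_partIndex_iff hκ ⟨i, by omega⟩ j).1 (by simp [h])

theorem partIndex_lt {κ : Fin s → ℕ} (hκ : Monotone κ) {j : ℕ} (hj : j < comp κ s) :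
    partIndex κ j < s := by
  refine (partIndex_le κ j).lt_of_ne fun h => ?_
  have := comp_partIndex_le hκ j
  rw [h] at this
  omega

theorem lt_comp_partIndex_succ {κ : Fin s → ℕ} (hκ : Monotone κ) {j : ℕ} (hj : j < comp κ s) :
    j < comp κ (partIndex κ j + 1) := by
  have h := partIndex_lt hκ hj
  rw [comp_succ κ ⟨_, h⟩]
  by_contra hle
  exact absurd ((lt_partIndex_iff hκ ⟨_, h⟩ j).2 (not_lt.1 hle)) (lt_irrefl _)

theorem prod_partIndex {α : Type*} [CommMonoid α] {κ : Fin s → ℕ} (hκ : Monotone κ)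
    (g : ℕ → ℕ → α) :
    ∏ j ∈ Finset.range (comp κ s), g j (partIndex κ j) =
      ∏ i : Fin s, ∏ j ∈ Finset.Ico (comp κ i) (κ i), g j i := by
  have key : ∀ m ≤ s, ∏ j ∈ Finset.range (comp κ m), g j (partIndex κ j) =
      ∏ i ∈ Finset.range m, ∏ j ∈ Finset.Ico (comp κ i) (comp κ (i + 1)), g j i := by
    intro m hm
    induction m with
    | zero => simp [comp_zero]
    | succ m ih =>
      rw [Finset.prod_range_succ, ← ih (by omega),
        ← Finset.prod_range_mul_prod_Ico _ (comp_le_comp_succ hκ hm)]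
      congr 1
      refine Finset.prod_congr rfl fun j hj => ?_
      rw [Finset.mem_Ico] at hj
      rw [partIndex_eq hκ hm hj.1 hj.2]
  rw [key s le_rfl, Finset.prod_range]
  simp only [comp_succ]

theorem shapeModule_eq_powModule {R : Type*} [CommRing R] (π : R) {κ : Fin s → ℕ}
    (hκ : Monotone κ) : shapeModule π κ = powModule π (partIndex κ) (comp κ s) := by
  ext x
  rw [mem_powModule]
  change (∀ (i : ℕ) (j : Fin (comp κ s)), i < s → comp κ i ≤ j → (j : ℕ) < comp κ (i + 1) →
    x j ∈ Ideal.span {π ^ i}) ↔ _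
  constructor
  · intro h j
    exact Ideal.mem_span_singleton.1
      (h _ j (partIndex_lt hκ j.2) (comp_partIndex_le hκ j) (lt_comp_partIndex_succ hκ j.2))
  · intro h i j hi h₁ h₂
    rw [Ideal.mem_span_singleton, ← partIndex_eq hκ hi h₁ h₂]
    exact h j

end Shapes

/-! ### Shapes as sizes of socle layers; counting submodules. -/

section SocleType

variable {R : Type*} [CommRing R]

/-- The layers of the filtration of the socle of `M` by the powers of `π` have the sizes
`q ^ μ i`. -/
def HasSocleType (π : R) (q : ℕ) {s : ℕ} (M : Type*) [AddCommGroup M] [Module R M]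
    (μ : Fin s → ℕ) : Prop :=
  ∀ i : Fin s, Nat.card (powSocle π M (s - 1 - i)) = q ^ μ i

variable {π : R} {q s : ℕ} {M M' : Type*} [AddCommGroup M] [Module R M]
  [AddCommGroup M'] [Module R M'] {μ ν κ : Fin s → ℕ}

theorem prod_card_powSocle (h : HasSocleType π q M μ) :
    ∏ b ∈ Finset.range s, Nat.card (powSocle π M b) = q ^ ∑ i, μ i := by
  rw [← Finset.prod_range_reflect, Finset.prod_range, ← Finset.prod_pow_eq_pow_sum]
  exact Finset.prod_congr rfl fun i _ => h i

theorem HasSocleType.card (hR : IsFiniteChainRing R π q s) (h : HasSocleType π q M μ) :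
    Nat.card M = q ^ ∑ i, μ i := by
  rw [card_eq_prod_card_powSocle π M hR.pow_length, prod_card_powSocle h]

theorem HasSocleType.card_torsionBy (h : HasSocleType π q M μ) (i : Fin s) :
    Nat.card (torsionBy R M (π ^ (s - 1 - i))) = q ^ ∑ l ∈ Finset.Ioi i, μ l := by
  rw [card_torsionBy_pow, ← Finset.prod_pow_eq_pow_sum]
  symm
  refine Finset.prod_bij' (fun l _ => s - 1 - (l : ℕ))
    (fun b _ => ⟨s - 1 - b, by have := i.2; omega⟩) ?_ ?_ ?_ ?_ ?_
  · intro l hl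
    have := l.2
    have hl := Finset.mem_Ioi.1 hl
    rw [Finset.mem_range]
    have : (i : ℕ) < l := hl
    omega
  · intro b hb
    rw [Finset.mem_range] at hb
    rw [Finset.mem_Ioi, Fin.lt_def]
    change (i : ℕ) < s - 1 - b
    omega
  · intro l _
    have := l.2
    ext
    simp only
    omega
  · intro b hb
    rw [Finset.mem_range] at hb
    simp only
    omega
  · intro l _
    exact (h l).symm

theorem HasSocleType.congr (e : M ≃ₗ[R] M') (h : HasSocleType π q M μ) :
    HasSocleType π q M' μ := fun i => by
  rw [← card_powSocle_congr π e, h i]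

theorem HasSocleType.prod (h : HasSocleType π q M μ) (h' : HasSocleType π q M' ν) :
    HasSocleType π q (M × M') (μ + ν) := fun i => by
  rw [card_powSocle_prod, h i, h' i, Pi.add_apply, pow_add]

section Finite

variable [Finite R]

theorem HasSocleType.le_of_injective [Finite M'] (hR : IsFiniteChainRing R π q s)
    (h : HasSocleType π q M μ) (h' : HasSocleType π q M' ν) (f : M →ₗ[R] M')
    (hf : Function.Injective f) : μ ≤ ν := fun i => by
  have := card_powSocle_le_of_injective π f hf (s - 1 - i)
  rw [h i, h' i] at this
  exact (Nat.pow_le_pow_iff_right hR.one_lt_residue).1 this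

theorem HasSocleType.le_of_surjective [Finite M] (hR : IsFiniteChainRing R π q s)
    (h : HasSocleType π q M μ) (h' : HasSocleType π q M' ν) (f : M →ₗ[R] M')
    (hf : Function.Surjective f) : ν ≤ μ := fun i => by
  have := card_powSocle_le_of_surjective π f hf (s - 1 - i)
  rw [h i, h' i] at this
  exact (Nat.pow_le_pow_iff_right hR.one_lt_residue).1 this

/-- Coordinate `j` contributes a factor `q` to layer `s - 1 - i` exactly when its exponent
`partIndex κ j` is at most `i`, that is, when `j < κ i`. -/
theorem hasSocleType_shapeModule (hR : IsFiniteChainRing R π q s) (hκ : Monotone κ) :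
    HasSocleType π q (shapeModule π κ) κ := fun i => by
  rw [shapeModule_eq_powModule π hκ, card_powSocle_powModule hR]
  have h : ∀ j, partIndex κ j + (s - 1 - i) < s ↔ j ∈ Finset.range (κ i) := by
    intro j
    have h1 := lt_partIndex_iff hκ i j
    have := i.2
    rw [Finset.mem_range]
    omega
  simp only [h]
  rw [Finset.prod_ite_mem, Finset.inter_eq_right.2 (Finset.range_mono (le_comp hκ i))]
  simp

theorem exists_hasSocleType (hR : IsFiniteChainRing R π q s) (M : Type*) [AddCommGroup M]
    [Module R M] [Finite M] : ∃ μ : Fin s → ℕ, Monotone μ ∧ HasSocleType π q M μ := by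
  have h : ∀ i : Fin s, ∃ k, Nat.card (powSocle π M (s - 1 - i)) = q ^ k := fun i =>
    hR.card_eq_pow_of_isTorsionBy _ fun x => Subtype.ext (mem_powSocle.1 x.2).1
  choose μ hμ using h
  refine ⟨μ, fun i j hij => ?_, hμ⟩
  rw [← Nat.pow_le_pow_iff_right hR.one_lt_residue, ← hμ, ← hμ]
  refine Nat.card_mono (Set.toFinite _) (powSocle_antitone π M ?_)
  have : (i : ℕ) ≤ j := hij
  omega

variable [Finite M]

theorem HasSocleType.card_injective (hR : IsFiniteChainRing R π q s) (h : HasSocleType π q M μ)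
    (hκ : Monotone κ) :
    Nat.card {f : shapeModule π κ →ₗ[R] M // Function.Injective f} =
      ∏ i : Fin s, ∏ j ∈ Finset.Ico (comp κ i) (κ i),
        ((q ^ μ i - q ^ j) * q ^ ∑ l ∈ Finset.Ioi i, μ l) := by
  rw [shapeModule_eq_powModule π hκ, card_injective_powModule hR (partIndex_monotone κ) _
    fun j hj => partIndex_lt hκ hj, prod_partIndex hκ fun j i =>
    (Nat.card (powSocle π M (s - 1 - i)) - q ^ j) * Nat.card (torsionBy R M (π ^ (s - 1 - i)))]
  simp only [h.card_torsionBy, h _]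

theorem HasSocleType.card_injective_pos (hR : IsFiniteChainRing R π q s)
    (h : HasSocleType π q M μ) (hκ : Monotone κ) (hle : κ ≤ μ) :
    0 < Nat.card {f : shapeModule π κ →ₗ[R] M // Function.Injective f} := by
  rw [h.card_injective hR hκ]
  refine Finset.prod_pos fun i _ => Finset.prod_pos fun j hj => Nat.mul_pos ?_ ?_
  · rw [Finset.mem_Ico] at hj
    exact Nat.sub_pos_of_lt (Nat.pow_lt_pow_right hR.one_lt_residue (hj.2.trans_le (hle i)))
  · exact pow_pos (zero_lt_one.trans hR.one_lt_residue) _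

theorem HasSocleType.exists_injective (hR : IsFiniteChainRing R π q s)
    (h : HasSocleType π q M μ) (hκ : Monotone κ) (hle : κ ≤ μ) :
    ∃ f : shapeModule π κ →ₗ[R] M, Function.Injective f := by
  obtain ⟨f, hf⟩ := (Nat.card_pos_iff.1 (h.card_injective_pos hR hκ hle)).1
  exact ⟨f, hf⟩

/-- The layer sizes give both an embedding of `R^κ` and the cardinality of `M`, and an embedding
between finite sets of equal size is a bijection. Shapes can henceforth be handled numerically. -/
theorem hasShape_iff (hR : IsFiniteChainRing R π q s) :
    HasShape π M κ ↔ Monotone κ ∧ HasSocleType π q M κ := by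
  refine and_congr_right fun hκ => ⟨?_, fun h => ?_⟩
  · rintro ⟨e⟩
    exact (hasSocleType_shapeModule hR hκ).congr e.symm
  · obtain ⟨f, hf⟩ := h.exists_injective hR hκ le_rfl
    refine ⟨(LinearEquiv.ofBijective f ((Nat.bijective_iff_injective_and_card f).2 ⟨hf, ?_⟩)).symm⟩
    rw [h.card hR, (hasSocleType_shapeModule hR hκ).card hR]

/-- Group the embeddings by their image: those with image `U` form a torsor under the automorphisms
of `R^κ`, which by finiteness are its injective endomorphisms. -/
theorem card_submodules_mul (π : R) (κ : Fin s → ℕ) (hκ : Monotone κ) :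
    Nat.card {U : Submodule R M // HasShape π U κ} *
      Nat.card {f : shapeModule π κ →ₗ[R] shapeModule π κ // Function.Injective f} =
      Nat.card {f : shapeModule π κ →ₗ[R] M // Function.Injective f} := by
  classical
  let F : {f : shapeModule π κ →ₗ[R] M // Function.Injective f} →
      {U : Submodule R M // HasShape π U κ} := fun f =>
    ⟨LinearMap.range f.1, hκ, ⟨(LinearEquiv.ofInjective f.1 f.2).symm⟩⟩
  have hF : ∀ U, Nat.card {f // F f = U} =
      Nat.card {f : shapeModule π κ →ₗ[R] shapeModule π κ // Function.Injective f} := by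
    rintro ⟨U, hU⟩
    obtain ⟨e⟩ := hU.2
    let G : {f : shapeModule π κ →ₗ[R] shapeModule π κ // Function.Injective f} →
        {f // F f = ⟨U, hU⟩} := fun g =>
      ⟨⟨U.subtype ∘ₗ e.symm.toLinearMap ∘ₗ g.1,
        U.injective_subtype.comp (e.symm.injective.comp g.2)⟩, by
        refine Subtype.ext ?_
        change LinearMap.range (U.subtype ∘ₗ e.symm.toLinearMap ∘ₗ g.1) = U
        have hg : Function.Surjective g.1 := Finite.surjective_of_injective g.2
        have : Function.Surjective (e.symm.toLinearMap ∘ₗ g.1) := e.symm.surjective.comp hg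
        rw [LinearMap.range_comp, LinearMap.range_eq_top.2 this, Submodule.map_top,
          Submodule.range_subtype]⟩
    refine (Nat.card_congr (Equiv.ofBijective G ⟨?_, ?_⟩)).symm
    · intro g g' h
      refine Subtype.ext (LinearMap.ext fun x => ?_)
      have h1 : (G g).1.1 x = (G g').1.1 x := by rw [h]
      exact e.symm.injective (U.injective_subtype h1)
    · rintro ⟨⟨f, hf⟩, hfU⟩
      have hr : LinearMap.range f = U := congrArg Subtype.val hfU
      subst hr
      refine ⟨⟨e.toLinearMap ∘ₗ f.rangeRestrict, e.injective.comp fun x y h => hf ?_⟩, ?_⟩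
      · exact congrArg Subtype.val h
      · refine Subtype.ext (Subtype.ext (LinearMap.ext fun x => ?_))
        simp [G]
  have : Finite (Submodule R M) := Finite.of_injective _ SetLike.coe_injective
  let _ : Fintype {U : Submodule R M // HasShape π U κ} := Fintype.ofFinite _
  have : Finite (shapeModule π κ →ₗ[R] M) := Finite.of_injective _ DFunLike.coe_injective
  rw [Nat.card_congr (Equiv.sigmaFiberEquiv F).symm, Nat.card_sigma, Finset.sum_congr rfl fun U _ =>
    hF U, Finset.sum_const, smul_eq_mul, Finset.card_univ, ← Nat.card_eq_fintype_card]

end Finite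

end SocleType

/-! ### The closed formula for the number of submodules. -/

section ShapeCoeff

variable {s : ℕ} {κ μ : Fin s → ℕ}

theorem prod_Ico_sub_pow {q a b m : ℕ} (hq : 1 < q) (hab : a ≤ b) (hbm : b ≤ m) :
    ∏ j ∈ Finset.Ico a b, ((q : ℝ) ^ m - (q : ℝ) ^ j) =
      gaussCoeff q (m - a) (b - a) * ∏ j ∈ Finset.Ico a b, ((q : ℝ) ^ b - (q : ℝ) ^ j) := by
  have hq' : (1 : ℝ) < q := by exact_mod_cast hq
  rw [Finset.prod_Ico_eq_prod_range, Finset.prod_Ico_eq_prod_range, gaussCoeff,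
    ← Finset.prod_mul_distrib]
  refine Finset.prod_congr rfl fun j hj => ?_
  rw [Finset.mem_range] at hj
  have h1 : (q : ℝ) ^ m = (q : ℝ) ^ a * (q : ℝ) ^ (m - a) := by
    rw [← pow_add, Nat.add_sub_cancel' (hab.trans hbm)]
  have h2 : (q : ℝ) ^ b = (q : ℝ) ^ a * (q : ℝ) ^ (b - a) := by
    rw [← pow_add, Nat.add_sub_cancel' hab]
  have h3 : (q : ℝ) ^ (b - a) - (q : ℝ) ^ j ≠ 0 :=
    (sub_pos.2 (pow_lt_pow_right₀ hq' hj)).ne'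
  rw [h1, h2, pow_add]
  field_simp

theorem sum_Iio_sub_comp (hκ : Monotone κ) (l : Fin s) :
    ∑ i ∈ Finset.Iio l, (κ i - comp κ i) = comp κ l := by
  have key : ∀ m ≤ s, ∑ i ∈ Finset.range m, (comp κ (i + 1) - comp κ i) = comp κ m := by
    intro m hm
    induction m with
    | zero => simp [comp_zero]
    | succ m ih =>
      rw [Finset.sum_range_succ, ih (by omega), Nat.add_sub_cancel' (comp_le_comp_succ hκ hm)]
  rw [← key l l.2.le, ← Nat.Iio_eq_range, ← Fin.map_valEmbedding_Iio, Finset.sum_map]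
  simp [comp_succ]

/-- Interchanging the sums leaves the telescoping sum of the increments of `κ`. This collects the
powers of `q` contributed by the torsion submodules in the embedding count. -/
theorem sum_mul_sub_comp (hκ : Monotone κ) (ν : Fin s → ℕ) :
    ∑ i, (∑ l ∈ Finset.Ioi i, ν l) * (κ i - comp κ i) = ∑ l, ν l * comp κ l := by
  rw [← Finset.sum_congr rfl fun l _ => congrArg (ν l * ·) (sum_Iio_sub_comp hκ l)]
  simp only [Finset.mul_sum, Finset.sum_mul]
  rw [Finset.sum_comm' (t' := Finset.univ) (s' := fun l => Finset.Iio l) (by simp)]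

theorem prod_eq_shapeCoeff_mul {q : ℕ} (hq : 1 < q) (hκ : Monotone κ) (hle : κ ≤ μ) :
    ∏ i : Fin s, ∏ j ∈ Finset.Ico (comp κ i) (κ i),
        (((q : ℝ) ^ μ i - (q : ℝ) ^ j) * (q : ℝ) ^ ∑ l ∈ Finset.Ioi i, μ l) =
      shapeCoeff q μ κ * ∏ i : Fin s, ∏ j ∈ Finset.Ico (comp κ i) (κ i),
        (((q : ℝ) ^ κ i - (q : ℝ) ^ j) * (q : ℝ) ^ ∑ l ∈ Finset.Ioi i, κ l) := by
  simp only [Finset.prod_mul_distrib, shapeCoeff, Finset.prod_const, Nat.card_Ico]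
  rw [Finset.prod_congr rfl fun i _ => prod_Ico_sub_pow hq (comp_le hκ i) (hle i)]
  simp only [Finset.prod_mul_distrib, ← pow_mul, Finset.prod_pow_eq_pow_sum]
  simp only [sum_mul_sub_comp hκ]
  have : ∑ l, μ l * comp κ l = ∑ l, (μ l - κ l) * comp κ l + ∑ l, κ l * comp κ l := by
    rw [← Finset.sum_add_distrib]
    refine Finset.sum_congr rfl fun l _ => ?_
    rw [← add_mul, Nat.sub_add_cancel (hle l)]
  rw [this, pow_add]
  ring

theorem cast_prod_sub {q : ℕ} (hq : 1 < q) (hle : κ ≤ μ) (ν : Fin s → ℕ) :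
    ((∏ i : Fin s, ∏ j ∈ Finset.Ico (comp κ i) (κ i),
        ((q ^ μ i - q ^ j) * q ^ ∑ l ∈ Finset.Ioi i, ν l) : ℕ) : ℝ) =
    ∏ i : Fin s, ∏ j ∈ Finset.Ico (comp κ i) (κ i),
        (((q : ℝ) ^ μ i - (q : ℝ) ^ j) * (q : ℝ) ^ ∑ l ∈ Finset.Ioi i, ν l) := by
  rw [Nat.cast_prod]
  refine Finset.prod_congr rfl fun i _ => ?_
  rw [Nat.cast_prod]
  refine Finset.prod_congr rfl fun j hj => ?_
  rw [Finset.mem_Ico] at hj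
  rw [Nat.cast_mul, Nat.cast_sub (Nat.pow_le_pow_right (by omega) (hj.2.le.trans (hle i)))]
  push_cast
  rfl

/-- The number of submodules of a given shape. -/
theorem card_submodules_of_shape {R : Type*} [CommRing R] [Finite R] {π : R} {q : ℕ}
    (hR : IsFiniteChainRing R π q s) {M : Type*} [AddCommGroup M] [Module R M] [Finite M]
    (h : HasSocleType π q M μ) (hκ : Monotone κ) (hle : κ ≤ μ) :
    (Nat.card {U : Submodule R M // HasShape π U κ} : ℝ) = shapeCoeff q μ κ := by
  have hS := hasSocleType_shapeModule hR hκ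
  have h1 := congrArg (Nat.cast : ℕ → ℝ) (card_submodules_mul (M := M) π κ hκ)
  have hpos := hS.card_injective_pos hR hκ le_rfl
  rw [Nat.cast_mul, h.card_injective hR hκ, cast_prod_sub hR.one_lt_residue hle,
    prod_eq_shapeCoeff_mul hR.one_lt_residue hκ hle, ← cast_prod_sub hR.one_lt_residue le_rfl,
    ← hS.card_injective hR hκ] at h1
  exact mul_right_cancel₀ (Nat.cast_ne_zero.2 hpos.ne') h1

end ShapeCoeff

/-! ### Counting generating tuples. -/

section Generators

theorem card_preimage_linearMap {R A B : Type*} [Ring R] [AddCommGroup A] [AddCommGroup B]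
    [Module R A] [Module R B] (φ : A →ₗ[R] B) (hφ : Function.Surjective φ) (P : B → Prop) :
    Nat.card {a // P (φ a)} = Nat.card {b // P b} * Nat.card (LinearMap.ker φ) := by
  rw [← Nat.card_prod]
  have hσ := Function.rightInverse_surjInv hφ
  set σ := Function.surjInv hφ
  refine Nat.card_congr ⟨fun a => (⟨φ a.1, a.2⟩, ⟨a.1 - σ (φ a.1), ?_⟩),
    fun x => ⟨x.2.1 + σ x.1.1, ?_⟩, fun a => ?_, fun x => ?_⟩
  · rw [LinearMap.mem_ker, map_sub, hσ, sub_self]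
  · rw [map_add, x.2.2, zero_add, hσ]
    exact x.1.2
  · simp
  · have h : φ (x.2.1 + σ x.1.1) = x.1.1 := by rw [map_add, x.2.2, zero_add, hσ]
    refine Prod.ext (Subtype.ext h) (Subtype.ext ?_)
    simp [h]

/-- In coordinates, the rows of an `N × k` matrix span `F^k` exactly when its `k` columns are
independent, since row rank equals column rank. -/
theorem card_spanning {F V : Type*} [Field F] [Finite F] [AddCommGroup V] [Module F V] [Finite V]
    (N : ℕ) (hN : Module.finrank F V ≤ N) :
    Nat.card {f : Fin N → V // span F (Set.range f) = ⊤} =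
      ∏ i : Fin (Module.finrank F V), (Nat.card F ^ N - Nat.card F ^ (i : ℕ)) := by
  classical
  let _ : Fintype F := Fintype.ofFinite F
  set k := Module.finrank F V with hk
  let e : V ≃ₗ[F] (Fin k → F) := LinearEquiv.ofFinrankEq _ _ (by simp [hk])
  have h := card_linearIndependent (K := F) (V := Fin N → F) (k := k) (by simpa using hN)
  rw [Module.finrank_fin_fun, ← Nat.card_eq_fintype_card] at h
  rw [← h]
  refine Nat.card_congr (((Equiv.refl (Fin N)).arrowCongr e.toEquiv).trans
    (Equiv.piComm fun _ _ => F) |>.subtypeEquiv fun f => ?_)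
  let A : Matrix (Fin N) (Fin k) F := fun i => e (f i)
  change span F (Set.range f) = ⊤ ↔ LinearIndependent F A.col
  have h1 : span F (Set.range A.row) = (span F (Set.range f)).map e.toLinearMap := by
    rw [Submodule.map_span, ← Set.range_comp]
    rfl
  rw [linearIndependent_iff_card_eq_finrank_span, Set.finrank, ← Matrix.rank_eq_finrank_span_cols,
    Matrix.rank_eq_finrank_span_row, h1, Fintype.card_fin, LinearEquiv.finrank_map_eq e]
  constructor
  · intro h2
    rw [h2, finrank_top]
  · intro h2
    exact Submodule.eq_top_of_finrank_eq (h2.symm.trans hk)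

variable {R : Type*} [CommRing R] {π : R} {q s : ℕ} {M : Type*} [AddCommGroup M]
  [Module R M] {κ : Fin s → ℕ}

theorem HasSocleType.card_torsionBy_self (hR : IsFiniteChainRing R π q s)
    (h : HasSocleType π q M κ) : Nat.card (torsionBy R M π) = q ^ comp κ s := by
  have h1 := card_torsionBy_pow_succ π M 0
  have hs := hR.length_pos
  have h2 := h ⟨s - 1, by omega⟩
  have h3 : s - 1 - (s - 1) = 0 := by omega
  have h4 : comp κ s = κ ⟨s - 1, by omega⟩ := by
    rw [← comp_succ κ ⟨s - 1, by omega⟩]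
    congr 1
    simp only
    omega
  simp only [h3] at h2
  simp only [zero_add, pow_one, pow_zero, torsionBy_one, h2, Nat.card_unique, one_mul] at h1
  rw [h1, h4]

variable [Finite R] [Finite M]

/-- By Nakayama's lemma a tuple generates `M` exactly when it spans `M/πM`, a space of dimension
`κ_s` over the residue field; each tuple there has `|πM|^N` lifts. -/
theorem card_generators (hR : IsFiniteChainRing R π q s) (h : HasSocleType π q M κ) {N : ℕ}
    (hN : comp κ s ≤ N) :
    (Nat.card {f : Fin N → M // span R (Set.range f) = ⊤} : ℝ) =
      (q : ℝ) ^ (N * ∑ i, κ i) *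
        ∏ i ∈ Finset.range (comp κ s), (1 - (q : ℝ) ^ ((i : ℤ) - (N : ℤ))) := by
  have hloc := hR.isLocalRing
  have hm : IsLocalRing.maximalIdeal R = Ideal.span {π} :=
    (IsLocalRing.eq_maximalIdeal hR.maximal).symm
  have hmax := hR.maximal
  let _ := Ideal.Quotient.field (Ideal.span {π})
  have hf : Finite (R ⧸ Ideal.span {π}) := Quotient.finite _
  set S : Submodule R M := Ideal.span {π} • ⊤ with hS
  have hSr : S = LinearMap.range (LinearMap.lsmul R M π) := by
    ext x
    rw [hS, Submodule.ideal_span_singleton_smul, Submodule.mem_smul_pointwise_iff_exists]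
    simp
  have hcard : Nat.card (M ⧸ S) * Nat.card S = Nat.card M := by
    rw [mul_comm]
    exact (card_eq_card_quotient_mul_card S).symm
  have hV : Nat.card (M ⧸ S) = q ^ comp κ s := by
    rw [← h.card_torsionBy_self hR]
    have h1 := card_torsionBy_mul_card_range M π
    rw [← hSr, ← hcard] at h1
    exact (Nat.eq_of_mul_eq_mul_right Nat.card_pos h1).symm
  have hfin : Finite (M ⧸ S) := Quotient.finite _
  have hrank : Module.finrank (R ⧸ Ideal.span {π}) (M ⧸ S) = comp κ s := by
    let _ := Fintype.ofFinite (R ⧸ Ideal.span {π})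
    let _ := Fintype.ofFinite (M ⧸ S)
    have h1 := Module.card_eq_pow_finrank (K := R ⧸ Ideal.span {π}) (V := M ⧸ S)
    rw [← Nat.card_eq_fintype_card, ← Nat.card_eq_fintype_card, hV, hR.card_residue] at h1
    exact (Nat.pow_right_injective hR.one_lt_residue h1).symm
  have hspan : ∀ f : Fin N → M, span R (Set.range f) = ⊤ ↔
      span (R ⧸ Ideal.span {π}) (Set.range (S.mkQ.compLeft (Fin N) f)) = ⊤ := by
    intro f
    rw [← IsLocalRing.map_mkQ_eq_top, hm, ← hS, Submodule.map_span, ← Set.range_comp,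
      ← Submodule.restrictScalars_span R (R ⧸ Ideal.span {π}) Ideal.Quotient.mk_surjective,
      Submodule.restrictScalars_eq_top_iff]
    rfl
  have hker : Nat.card (LinearMap.ker (S.mkQ.compLeft (Fin N))) = Nat.card S ^ N := by
    have h1 : Nat.card (Fin N → S) = Nat.card S ^ N := by
      rw [Nat.card_fun, Nat.card_eq_fintype_card (α := Fin N), Fintype.card_fin]
    rw [← h1]
    refine Nat.card_congr ⟨fun f i => ⟨f.1 i, ?_⟩, fun g => ⟨fun i => (g i).1, ?_⟩, fun f => rfl,
      fun g => rfl⟩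
    · have := congrFun f.2 i
      exact (Submodule.Quotient.mk_eq_zero S).1 this
    · exact funext fun i => (Submodule.Quotient.mk_eq_zero S).2 (g i).2
  have hcount : Nat.card {f : Fin N → M // span R (Set.range f) = ⊤} =
      (∏ i ∈ Finset.range (comp κ s), (q ^ N - q ^ i)) * Nat.card S ^ N := by
    simp only [hspan]
    rw [card_preimage_linearMap (S.mkQ.compLeft (Fin N))
      ((Submodule.mkQ_surjective S).comp_left) fun b =>
      span (R ⧸ Ideal.span {π}) (Set.range b) = ⊤, hker, card_spanning N (hrank.trans_le hN), hrank,
      hR.card_residue, Finset.prod_range]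
  have hq : (1 : ℝ) < q := by exact_mod_cast hR.one_lt_residue
  have hSq : (q : ℝ) ^ comp κ s * Nat.card S = (q : ℝ) ^ ∑ i, κ i := by
    rw [hV, h.card hR] at hcard
    exact_mod_cast hcard
  rw [hcount, mul_comm N, pow_mul, ← hSq, mul_pow, Nat.cast_mul, Nat.cast_prod, Nat.cast_pow,
    mul_right_comm]
  congr 1
  rw [← pow_mul, mul_comm (comp κ s), pow_mul, ← Finset.card_range (comp κ s),
    ← Finset.prod_const, Finset.card_range, ← Finset.prod_mul_distrib]
  refine Finset.prod_congr rfl fun i hi => ?_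
  rw [Finset.mem_range] at hi
  rw [Nat.cast_sub (Nat.pow_le_pow_right (by linarith [hR.one_lt_residue]) (by omega)),
    mul_sub, mul_one, zpow_sub₀ (by positivity), zpow_natCast, zpow_natCast,
    mul_div_cancel₀ _ (by positivity)]
  push_cast
  rfl

end Generators

/-! ### Counting matrices of a given shape. -/

section MatrixCount

variable {R : Type*} [CommRing R] {π : R} {q s : ℕ} {μ κ : Fin s → ℕ}

theorem hasShape_rowSpan_iff {N m : ℕ} {L : Submodule R (Fin m → R)} (f : Fin N → L) :
    HasShape π (rowSpan (Matrix.of fun i => (f i).1)) κ ↔ HasShape π (span R (Set.range f)) κ := by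
  have h : rowSpan (Matrix.of fun i => (f i).1) = (span R (Set.range f)).map L.subtype := by
    rw [rowSpan, Submodule.map_span, ← Set.range_comp]
    rfl
  rw [h]
  have e := (span R (Set.range f)).equivMapOfInjective L.subtype L.injective_subtype
  exact and_congr_right fun _ => ⟨fun ⟨e'⟩ => ⟨e.trans e'⟩, fun ⟨e'⟩ => ⟨e.symm.trans e'⟩⟩

variable [Finite R]

/-- The number of matrices of a given shape, all of whose rows lie in a given module. -/
theorem card_matrices_of_shape (hR : IsFiniteChainRing R π q s) {m : ℕ}
    {L : Submodule R (Fin m → R)} (h : HasSocleType π q L μ) (hκ : Monotone κ) (hle : κ ≤ μ)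
    {N : ℕ} (hN : comp κ s ≤ N) :
    (Nat.card {A : Matrix (Fin N) (Fin m) R // (∀ i, A.row i ∈ L) ∧ HasShape π (rowSpan A) κ} : ℝ) =
      shapeCoeff q μ κ * ((q : ℝ) ^ (N * ∑ i, κ i) *
        ∏ i ∈ Finset.range (comp κ s), (1 - (q : ℝ) ^ ((i : ℤ) - (N : ℤ)))) := by
  classical
  let E : {A : Matrix (Fin N) (Fin m) R // (∀ i, A.row i ∈ L) ∧ HasShape π (rowSpan A) κ} ≃
      {f : Fin N → L // HasShape π (span R (Set.range f)) κ} :=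
    ⟨fun A => ⟨fun i => ⟨A.1 i, A.2.1 i⟩, (hasShape_rowSpan_iff _).1 A.2.2⟩,
      fun f => ⟨fun i => (f.1 i).1, fun i => (f.1 i).2, (hasShape_rowSpan_iff f.1).2 f.2⟩,
      fun A => rfl, fun f => rfl⟩
  let F : {f : Fin N → L // HasShape π (span R (Set.range f)) κ} →
      {U : Submodule R L // HasShape π U κ} := fun f => ⟨span R (Set.range f.1), f.2⟩
  -- Over each submodule `U` the fiber consists of the generating `N`-tuples of `U`, whose number
  -- depends on the shape only.
  have hF : ∀ U, (Nat.card {f // F f = U} : ℝ) = (q : ℝ) ^ (N * ∑ i, κ i) *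
      ∏ i ∈ Finset.range (comp κ s), (1 - (q : ℝ) ^ ((i : ℤ) - (N : ℤ))) := by
    rintro ⟨U, hU⟩
    rw [← card_generators hR ((hasShape_iff hR).1 hU).2 hN]
    have hspan : ∀ f : Fin N → U, span R (Set.range fun i => (f i).1) =
        (span R (Set.range f)).map U.subtype := fun f => by
      rw [Submodule.map_span, ← Set.range_comp]
      rfl
    have hiff : ∀ f : Fin N → U, span R (Set.range fun i => (f i).1) = U ↔
        span R (Set.range f) = ⊤ := fun f => by
      rw [hspan]
      constructor
      · intro h
        refine Submodule.map_injective_of_injective U.injective_subtype ?_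
        rw [h, Submodule.map_top, Submodule.range_subtype]
      · intro h
        rw [h, Submodule.map_top, Submodule.range_subtype]
    congr 1
    refine Nat.card_congr ⟨fun f => ⟨fun i => ⟨f.1.1 i, ?_⟩, (hiff _).1 (congrArg Subtype.val f.2)⟩,
      fun f => ⟨⟨fun i => (f.1 i).1, ?_⟩, Subtype.ext ((hiff f.1).2 f.2)⟩, fun f => rfl,
      fun f => rfl⟩
    · have h1 : span R (Set.range f.1.1) = U := congrArg Subtype.val f.2
      exact h1.le (subset_span ⟨i, rfl⟩)
    · rw [(hiff f.1).2 f.2]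
      exact hU
  have : Finite (Submodule R L) := Finite.of_injective _ SetLike.coe_injective
  let _ : Fintype {U : Submodule R L // HasShape π U κ} := Fintype.ofFinite _
  rw [Nat.card_congr E, Nat.card_congr (Equiv.sigmaFiberEquiv F).symm, Nat.card_sigma,
    Nat.cast_sum, Finset.sum_congr rfl fun U _ => hF U, Finset.sum_const, Finset.card_univ,
    ← Nat.card_eq_fintype_card, nsmul_eq_mul, card_submodules_of_shape hR h hκ hle]

theorem hasSocleType_pi (hR : IsFiniteChainRing R π q s) (m : ℕ) :
    HasSocleType π q (Fin m → R) fun _ : Fin s => m := by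
  have h : HasSocleType π q (shapeModule π fun _ : Fin s => m) fun _ => m :=
    hasSocleType_shapeModule hR monotone_const
  have hm : comp (fun _ : Fin s => m) s = m := by
    have := hR.length_pos
    simp only [comp]
    rw [dif_pos ⟨this, le_rfl⟩]
  have htop : shapeModule π (fun _ : Fin s => m) = ⊤ := by
    rw [eq_top_iff]
    intro x _ i j hi h₁ h₂
    rcases i with _ | i
    · simp
    · rw [comp_succ _ ⟨i, by omega⟩] at h₁
      have := j.2
      omega
  rw [htop] at h
  have h2 := h.congr Submodule.topEquiv
  rwa [hm] at h2

theorem card_matricesOfShape (hR : IsFiniteChainRing R π q s) {m : ℕ} (hκ : Monotone κ)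
    (hle : ∀ i, κ i ≤ m) {N : ℕ} (hN : ∀ i, κ i ≤ N) :
    (Nat.card (matricesOfShape π N m κ) : ℝ) =
      shapeCoeff q (fun _ => m) κ * ((q : ℝ) ^ (N * ∑ i, κ i) *
        ∏ i ∈ Finset.range (comp κ s), (1 - (q : ℝ) ^ ((i : ℤ) - (N : ℤ)))) := by
  have h : HasSocleType π q (⊤ : Submodule R (Fin m → R)) fun _ : Fin s => m :=
    (hasSocleType_pi hR m).congr Submodule.topEquiv.symm
  rw [← card_matrices_of_shape hR h hκ hle (comp_le_of_forall_le hN s)]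
  congr 1
  exact Nat.card_congr (Equiv.subtypeEquivRight fun A => by simp [matricesOfShape])

theorem card_rowMatricesOfShape (hR : IsFiniteChainRing R π q s) (hμ : Monotone μ)
    (hκ : Monotone κ) (hle : κ ≤ μ) {N : ℕ} (hN : ∀ i, κ i ≤ N) :
    (Nat.card (rowMatricesOfShape π N μ κ) : ℝ) =
      shapeCoeff q μ κ * ((q : ℝ) ^ (N * ∑ i, κ i) *
        ∏ i ∈ Finset.range (comp κ s), (1 - (q : ℝ) ^ ((i : ℤ) - (N : ℤ)))) :=
  card_matrices_of_shape hR (hasSocleType_shapeModule hR hμ) hκ hle (comp_le_of_forall_le hN s)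

end MatrixCount

/-! ### Equal row spans and invertible left factors. -/

section RowEquivalence

/-- Matrix rings over a field have stable range one. -/
theorem exists_injective_add_comp {F V : Type*} [Field F] [AddCommGroup V] [Module F V]
    [FiniteDimensional F V] (C G : V →ₗ[F] V) (h : ∀ v, C v = 0 → G v = 0 → v = 0) :
    ∃ E : V →ₗ[F] V, Function.Injective (C + E ∘ₗ G) := by
  obtain ⟨W, hW⟩ := Submodule.exists_isCompl (LinearMap.range C)
  have hfr : Module.finrank F (LinearMap.ker C) = Module.finrank F W := by
    have h1 := LinearMap.finrank_range_add_finrank_ker C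
    have h2 := Submodule.finrank_add_eq_of_isCompl hW
    omega
  let φ := LinearEquiv.ofFinrankEq (LinearMap.ker C) W hfr
  obtain ⟨H, hH⟩ := LinearMap.exists_leftInverse_of_injective (G ∘ₗ (LinearMap.ker C).subtype) (by
    rw [LinearMap.ker_eq_bot']
    rintro ⟨v, hv⟩ hGv
    exact Subtype.ext (h v hv hGv))
  -- This `E` undoes `G` on `ker C` and then carries `ker C` isomorphically onto a complement of
  -- `range C`. So `C v + E (G v) = 0` forces both terms to vanish.
  refine ⟨W.subtype ∘ₗ φ.toLinearMap ∘ₗ H, ?_⟩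
  rw [← LinearMap.ker_eq_bot, LinearMap.ker_eq_bot']
  intro v hv
  have hv' : C v + (φ (H (G v)) : V) = 0 := hv
  have hC : C v = 0 := by
    refine Submodule.disjoint_def.1 hW.disjoint _ (LinearMap.mem_range_self C v) ?_
    rw [eq_neg_of_add_eq_zero_left hv']
    exact neg_mem (φ (H (G v))).2
  rw [hC, zero_add] at hv'
  have h1 : φ (H (G v)) = 0 := Subtype.ext hv'
  rw [φ.map_eq_zero_iff] at h1
  have h2 : H (G v) = ⟨v, hC⟩ := LinearMap.congr_fun hH ⟨v, hC⟩
  exact congrArg Subtype.val (h2.symm.trans h1)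

variable {R : Type*} [CommRing R]

theorem rowSpan_mul_le {N n m : ℕ} (T : Matrix (Fin N) (Fin n) R) (Y : Matrix (Fin n) (Fin m) R) :
    rowSpan (T * Y) ≤ rowSpan Y := by
  rw [rowSpan, span_le]
  rintro _ ⟨i, rfl⟩
  rw [SetLike.mem_coe, rowSpan, Submodule.mem_span_range_iff_exists_fun]
  refine ⟨T i, ?_⟩
  ext j
  simp [Matrix.mul_apply, Matrix.row]

theorem exists_eq_mul_of_rowSpan_le {N n m : ℕ} {Y : Matrix (Fin n) (Fin m) R}
    {Y' : Matrix (Fin N) (Fin m) R} (h : rowSpan Y' ≤ rowSpan Y) :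
    ∃ T : Matrix (Fin N) (Fin n) R, Y' = T * Y := by
  have h1 : ∀ i, ∃ c : Fin n → R, ∑ j, c j • Y.row j = Y'.row i := fun i =>
    (Submodule.mem_span_range_iff_exists_fun R).1 (h (subset_span ⟨i, rfl⟩))
  choose T hT using h1
  refine ⟨Matrix.of T, ?_⟩
  ext i j
  have := congrFun (hT i) j
  simp only [Finset.sum_apply, Pi.smul_apply, smul_eq_mul, Matrix.row] at this
  rw [Matrix.mul_apply]
  exact this.symm

theorem rowSpan_unit_mul {N m : ℕ} {T : Matrix (Fin N) (Fin N) R} (hT : IsUnit T)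
    (Y : Matrix (Fin N) (Fin m) R) : rowSpan (T * Y) = rowSpan Y := by
  refine le_antisymm (rowSpan_mul_le T Y) ?_
  obtain ⟨u, rfl⟩ := hT
  have := rowSpan_mul_le (↑u⁻¹ : Matrix (Fin N) (Fin N) R) ((u : Matrix (Fin N) (Fin N) R) * Y)
  rwa [← Matrix.mul_assoc, Units.inv_mul, Matrix.one_mul] at this

variable {π : R} {q s : ℕ}

/-- Matrices with the same row span are row equivalent. -/
theorem exists_unit_mul_eq (hR : IsFiniteChainRing R π q s) {N m : ℕ}
    {Y Y' : Matrix (Fin N) (Fin m) R} (h : rowSpan Y = rowSpan Y') :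
    ∃ T : Matrix (Fin N) (Fin N) R, IsUnit T ∧ Y' = T * Y := by
  obtain ⟨C, hC⟩ := exists_eq_mul_of_rowSpan_le h.ge
  obtain ⟨D, hD⟩ := exists_eq_mul_of_rowSpan_le h.le
  have hmax := hR.maximal
  let _ := Ideal.Quotient.field (Ideal.span {π})
  let φ := Ideal.Quotient.mk (Ideal.span {π})
  -- Hence `C + E' (1 - D C)` sends `Y` to `Y'` for every `E'`. Modulo `π`, the kernels of `C` and
  -- `1 - D C` meet trivially, so stable range one over the residue field supplies an `E'` making it
  -- invertible.
  have hG : (1 - D * C) * Y = 0 := by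
    rw [Matrix.sub_mul, Matrix.one_mul, Matrix.mul_assoc, ← hC, ← hD, sub_self]
  obtain ⟨E, hE⟩ := exists_injective_add_comp (Matrix.toLin' (C.map φ))
    (Matrix.toLin' ((1 - D * C).map φ)) (by
    intro v h1 h2
    rw [Matrix.toLin'_apply] at h1 h2
    rw [Matrix.map_sub φ (map_sub φ), Matrix.map_one φ (map_zero φ) (map_one φ), Matrix.map_mul,
      Matrix.sub_mulVec, ← Matrix.mulVec_mulVec, h1, Matrix.mulVec_zero, sub_zero,
      Matrix.one_mulVec] at h2
    exact h2)
  choose σ hσ using Ideal.Quotient.mk_surjective (I := Ideal.span {π})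
  let E' : Matrix (Fin N) (Fin N) R := (LinearMap.toMatrix' E).map σ
  have hE' : E'.map φ = LinearMap.toMatrix' E := by
    ext i j
    exact hσ _
  refine ⟨C + E' * (1 - D * C), ?_, ?_⟩
  · rw [Matrix.isUnit_iff_isUnit_det, hR.isUnit_iff, ← Ideal.mem_span_singleton,
      ← Ideal.Quotient.eq_zero_iff_mem]
    have h1 : (C + E' * (1 - D * C)).map φ =
        LinearMap.toMatrix' (Matrix.toLin' (C.map φ) + E ∘ₗ Matrix.toLin' ((1 - D * C).map φ)) := by
      rw [map_add, LinearMap.toMatrix'_comp, LinearMap.toMatrix'_toLin', LinearMap.toMatrix'_toLin',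
        ← hE', Matrix.map_add φ (map_add φ), Matrix.map_mul]
    have h2 := LinearMap.isUnit_det _
      ((LinearMap.isUnit_iff_ker_eq_bot _).2 (LinearMap.ker_eq_bot.2 hE))
    rw [← LinearMap.det_toMatrix', ← h1] at h2
    have h3 : φ (C + E' * (1 - D * C)).det = ((C + E' * (1 - D * C)).map φ).det :=
      RingHom.map_det φ _
    change φ _ ≠ 0
    rw [h3]
    exact h2.ne_zero
  · rw [Matrix.add_mul, Matrix.mul_assoc, hG, Matrix.mul_zero, add_zero, hC]

end RowEquivalence

/-! ### Shapes of row spans and the double count. -/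

section RowSpanType

variable {R : Type*} [CommRing R] [Finite R] {π : R} {q s : ℕ} {ν τ : Fin s → ℕ}

theorem HasSocleType.le_of_rowSpan (hR : IsFiniteChainRing R π q s) {N m : ℕ}
    {Y : Matrix (Fin N) (Fin m) R} (h : HasSocleType π q (rowSpan Y) ν) (i : Fin s) :
    ν i ≤ N := by
  have h1 : LinearMap.range Y.vecMulLinear = rowSpan Y := range_vecMulLinear Y
  rw [← h1] at h
  exact (hasSocleType_pi hR N).le_of_surjective hR h _ (LinearMap.surjective_rangeRestrict _) i

/-- The row span of `Y` embeds in a quotient of `R^n × rowSpan (Y - A X)`, and layer sizes are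
monotone under both operations. -/
theorem HasSocleType.le_add_of_rowSpan (hR : IsFiniteChainRing R π q s) {N n m : ℕ}
    {Y : Matrix (Fin N) (Fin m) R} (h : HasSocleType π q (rowSpan Y) ν)
    (A : Matrix (Fin N) (Fin n) R) (X : Matrix (Fin n) (Fin m) R)
    (hτ : HasSocleType π q (rowSpan (Y - A * X)) τ) (i : Fin s) : ν i ≤ n + τ i := by
  let f := X.vecMulLinear.coprod (rowSpan (Y - A * X)).subtype
  have hle : rowSpan Y ≤ LinearMap.range f := by
    rw [rowSpan, span_le]
    rintro _ ⟨j, rfl⟩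
    refine ⟨(A.row j, ⟨(Y - A * X).row j, subset_span ⟨j, rfl⟩⟩), ?_⟩
    ext l
    simp [f, Matrix.vecMul, Matrix.mul_apply, dotProduct, Matrix.row]
  obtain ⟨ρ, -, hρ⟩ := exists_hasSocleType hR (LinearMap.range f)
  have h1 := ((hasSocleType_pi hR n).prod hτ).le_of_surjective hR hρ f.rangeRestrict
    f.surjective_rangeRestrict
  have h2 := h.le_of_injective hR hρ (Submodule.inclusion hle) (Submodule.inclusion_injective hle)
  exact (h2 i).trans (h1 i)

/-- A submodule of a free module whose shape is at most `m'` is embedded in `R ^ m'` by a linear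
map that is defined on the whole free module. -/
theorem exists_linearMap_injOn (hR : IsFiniteChainRing R π q s) {m m' : ℕ}
    {U : Submodule R (Fin m → R)} (hU : HasShape π U ν) (hle : ∀ i, ν i ≤ m') :
    ∃ P : (Fin m → R) →ₗ[R] (Fin m' → R), Set.InjOn P U := by
  obtain ⟨e⟩ := hU.2
  obtain ⟨f, hf⟩ := (hasSocleType_pi hR m').exists_injective hR hU.1 hle
  -- Self-injectivity of `R` extends each coordinate of the embedding of `U` to the whole free
  -- module.
  have h : ∀ j, ∃ P : (Fin m → R) →ₗ[R] R,
      P ∘ₗ U.subtype = LinearMap.proj j ∘ₗ f ∘ₗ e.toLinearMap := fun j =>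
    Module.Baer.extension_property hR.baer U.subtype U.injective_subtype _
  choose P hP using h
  refine ⟨LinearMap.pi P, fun x hx y hy hxy => ?_⟩
  have hfe : ∀ z : U, LinearMap.pi P z = f (e z) := fun z => funext fun j =>
    LinearMap.congr_fun (hP j) z
  have := (hfe ⟨x, hx⟩).symm.trans (hxy.trans (hfe ⟨y, hy⟩))
  exact congrArg Subtype.val (e.injective (hf this))

/-- The number of matrices with a given row span, of small shape, whose difference from a given
matrix has a given shape. -/
theorem card_rowSpan_eq_le (hR : IsFiniteChainRing R π q s) {N m m' : ℕ}
    {U : Submodule R (Fin m → R)} (hU : HasShape π U ν) (hle : ∀ i, ν i ≤ m')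
    (B : Matrix (Fin N) (Fin m) R) (τ : Fin s → ℕ) :
    Nat.card {Y : Matrix (Fin N) (Fin m) R // rowSpan Y = U ∧ HasShape π (rowSpan (Y - B)) τ} ≤
      ∑ τ' ∈ subshapes τ, Nat.card (matricesOfShape π N m' τ') := by
  classical
  obtain ⟨P, hP⟩ := exists_linearMap_injOn hR hU hle
  let W : Matrix (Fin N) (Fin m) R → Matrix (Fin N) (Fin m') R := fun Z =>
    Matrix.of fun i => P (Z.row i)
  have hspan : ∀ Z, rowSpan (W Z) = (rowSpan Z).map P := fun Z => by
    rw [rowSpan, rowSpan, Submodule.map_span, ← Set.range_comp]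
    rfl
  have hW : ∀ Z, HasShape π (rowSpan Z) τ → ∃ τ' ∈ subshapes τ, W Z ∈ matricesOfShape π N m' τ' := by
    intro Z hZ
    obtain ⟨τ', hmono, hτ'⟩ := exists_hasSocleType hR (rowSpan (W Z))
    refine ⟨τ', ?_, (hasShape_iff hR).2 ⟨hmono, hτ'⟩⟩
    have h1 := ((hasShape_iff hR).1 hZ).2
    rw [hspan] at hτ'
    simp only [subshapes, Finset.mem_filter, Finset.mem_Iic]
    refine ⟨h1.le_of_surjective hR hτ' (P.submoduleMap (rowSpan Z))
      (P.submoduleMap_surjective (rowSpan Z)), hmono⟩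
  choose τ' hτ' hWτ' using hW
  rw [← Finset.sum_coe_sort, ← Nat.card_sigma]
  let F : {Y : Matrix (Fin N) (Fin m) R // rowSpan Y = U ∧ HasShape π (rowSpan (Y - B)) τ} →
      Σ t : subshapes τ, matricesOfShape π N m' t.1 := fun Y => ⟨⟨τ' _ Y.2.2, hτ' _ Y.2.2⟩, W (Y.1 - B),
    hWτ' _ Y.2.2⟩
  refine Nat.card_le_card_of_injective F fun Y Y' h => ?_
  have h1 : W (Y.1 - B) = W (Y'.1 - B) :=
    congrArg (fun x : Σ t : subshapes τ, matricesOfShape π N m' t.1 => x.2.1) h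
  -- The rows of `B` need not lie in `U`: by linearity `P` of them cancels, and `P` is injective on
  -- the rows of `Y` and `Y'`, which do lie in `U`.
  refine Subtype.ext (funext fun i => hP ?_ ?_ ?_)
  · exact Y.2.1.le (subset_span ⟨i, rfl⟩)
  · exact Y'.2.1.le (subset_span ⟨i, rfl⟩)
  · have h2 : P (Y.1 i - B i) = P (Y'.1 i - B i) := congrFun h1 i
    rwa [map_sub, map_sub, sub_left_inj] at h2

/-- Double counting of pairs `(Y', A)`: left multiplication by units transports the admissible `A`
for `Y` to those for any `Y'` with the same row span, while each `A` admits at most `K` such `Y'`.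
-/
theorem card_rowSpan_mul_card_le (hR : IsFiniteChainRing R π q s) {N n m m' : ℕ}
    (X : Matrix (Fin n) (Fin m) R) (𝒜 : Set (Matrix (Fin N) (Fin n) R))
    (h𝒜 : ∀ T : Matrix (Fin N) (Fin N) R, IsUnit T → ∀ A ∈ 𝒜, T * A ∈ 𝒜)
    (hm' : ∀ i, min N (n + τ i) ≤ m') (Y : Matrix (Fin N) (Fin m) R) :
    Nat.card {Y' : Matrix (Fin N) (Fin m) R // rowSpan Y' = rowSpan Y} *
      Nat.card {A : 𝒜 // HasShape π (rowSpan (Y - A.1 * X)) τ} ≤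
    Nat.card 𝒜 * ∑ τ' ∈ subshapes τ, Nat.card (matricesOfShape π N m' τ') := by
  classical
  set K := ∑ τ' ∈ subshapes τ, Nat.card (matricesOfShape π N m' τ')
  let _ : Fintype {Y' : Matrix (Fin N) (Fin m) R // rowSpan Y' = rowSpan Y} := Fintype.ofFinite _
  let _ : Fintype 𝒜 := Fintype.ofFinite _
  have h1 : ∀ Y' : {Y' : Matrix (Fin N) (Fin m) R // rowSpan Y' = rowSpan Y},
      Nat.card {A : 𝒜 // HasShape π (rowSpan (Y - A.1 * X)) τ} ≤
      Nat.card {A : 𝒜 // HasShape π (rowSpan (Y'.1 - A.1 * X)) τ} := by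
    rintro ⟨Y', hY'⟩
    obtain ⟨T, hT, rfl⟩ := exists_unit_mul_eq hR hY'.symm
    refine Nat.card_le_card_of_injective (fun A => ⟨⟨T * A.1.1, h𝒜 T hT _ A.1.2⟩, ?_⟩) ?_
    · rw [Matrix.mul_assoc, ← Matrix.mul_sub, rowSpan_unit_mul hT]
      exact A.2
    · intro A A' h
      have h2 : T * A.1.1 = T * A'.1.1 := congrArg (fun A => A.1.1) h
      obtain ⟨u, rfl⟩ := hT
      have h3 : ∀ B : Matrix (Fin N) (Fin n) R,
          (↑u⁻¹ : Matrix (Fin N) (Fin N) R) * ((u : Matrix (Fin N) (Fin N) R) * B) = B := fun B => by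
        rw [← Matrix.mul_assoc, Units.inv_mul, Matrix.one_mul]
      refine Subtype.ext (Subtype.ext ?_)
      rw [← h3 A.1.1, h2, h3]
  have h2 : ∀ A : 𝒜, Nat.card {Y' : {Y' : Matrix (Fin N) (Fin m) R // rowSpan Y' = rowSpan Y} //
      HasShape π (rowSpan (Y'.1 - A.1 * X)) τ} ≤ K := by
    intro A
    rw [Nat.card_congr (Equiv.subtypeSubtypeEquivSubtypeInter _ fun Y' =>
      HasShape π (rowSpan (Y' - A.1 * X)) τ)]
    -- Bounding the shape of the row span by `n + τ` needs one admissible `Y'` for this `A`; without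
    -- one there is nothing to count.
    rcases isEmpty_or_nonempty {Y' : Matrix (Fin N) (Fin m) R // rowSpan Y' = rowSpan Y ∧
      HasShape π (rowSpan (Y' - A.1 * X)) τ} with hem | ⟨⟨Y', hY', hsh⟩⟩
    · rw [Nat.card_of_isEmpty]
      exact Nat.zero_le _
    · obtain ⟨ρ, hmono, hρ⟩ := exists_hasSocleType hR (rowSpan Y)
      refine card_rowSpan_eq_le hR ((hasShape_iff hR).2 ⟨hmono, hρ⟩) (fun i => ?_) _ τ
      rw [← hY'] at hρ
      exact (le_min (hρ.le_of_rowSpan hR i)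
        (hρ.le_add_of_rowSpan hR A.1 X ((hasShape_iff hR).1 hsh).2 i)).trans (hm' i)
  have hswap : (Σ Y' : {Y' : Matrix (Fin N) (Fin m) R // rowSpan Y' = rowSpan Y},
      {A : 𝒜 // HasShape π (rowSpan (Y'.1 - A.1 * X)) τ}) ≃
      Σ A : 𝒜, {Y' : {Y' : Matrix (Fin N) (Fin m) R // rowSpan Y' = rowSpan Y} //
      HasShape π (rowSpan (Y'.1 - A.1 * X)) τ} :=
    ⟨fun x => ⟨x.2.1, x.1, x.2.2⟩, fun x => ⟨x.2.1, x.1, x.2.2⟩, fun x => rfl, fun x => rfl⟩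
  calc _ = ∑ _Y' : {Y' : Matrix (Fin N) (Fin m) R // rowSpan Y' = rowSpan Y},
        Nat.card {A : 𝒜 // HasShape π (rowSpan (Y - A.1 * X)) τ} := by
        rw [Finset.sum_const, Finset.card_univ, smul_eq_mul, Nat.card_eq_fintype_card (α :=
          {Y' : Matrix (Fin N) (Fin m) R // rowSpan Y' = rowSpan Y})]
    _ ≤ _ := Finset.sum_le_sum fun Y' _ => h1 Y'
    _ = _ := by rw [← Nat.card_sigma, Nat.card_congr hswap, Nat.card_sigma]
    _ ≤ _ := Finset.sum_le_sum fun A _ => h2 A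
    _ = _ := by rw [Finset.sum_const, Finset.card_univ, smul_eq_mul,
      Nat.card_eq_fintype_card (α := 𝒜)]

end RowSpanType

/-! ### Entropy bounds through a statistic of the output. -/

section Information

variable {α β γ : Type*} [Fintype α] [Fintype β] [DecidableEq γ]

/-- A form of Gibbs' inequality: a law on `β` that charges the fibers of `f` over the points of `S`
only. -/
theorem sum_negMulLog_le (f : β → γ) (S : Finset γ) (P : β → ℝ) (hP : ∀ y, 0 ≤ P y)
    (hsum : ∑ y, P y = 1) (hS : ∀ y, P y ≠ 0 → f y ∈ S) :
    ∑ y, Real.negMulLog (P y) ≤ Real.log S.card +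
      ∑ y, P y * Real.log (Finset.univ.filter fun y' => f y' = f y).card := by
  have hSpos : (0 : ℝ) < S.card := by
    rcases S.eq_empty_or_nonempty with rfl | h
    · have : ∀ y, P y = 0 := fun y => by
        by_contra hy
        simpa using hS y hy
      simp [this] at hsum
    · exact_mod_cast h.card_pos
  set c : γ → ℝ := fun g => ((Finset.univ.filter fun y' => f y' = g).card : ℝ) with hc
  have hcpos : ∀ y, 0 < c (f y) := fun y => by
    simp only [hc]
    exact_mod_cast Finset.card_pos.2 ⟨y, by simp⟩
  -- The comparison measure picks a point of `S` uniformly, then a point of its fiber uniformly; the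
  -- bound is `log x ≤ x - 1` at the ratio of this measure to `P`. Points of `S` with empty fiber
  -- lose mass, so the total is only at most one.
  have hterm : ∀ y, Real.negMulLog (P y) ≤ P y * Real.log S.card + P y * Real.log (c (f y)) +
      ((if f y ∈ S then 1 / (S.card * c (f y)) else 0) - P y) := by
    intro y
    by_cases hy : P y = 0
    · rw [hy]
      have h1 : 0 ≤ 1 / (S.card * c (f y)) := by
        have := hcpos y
        positivity
      have h2 : (0 : ℝ) ≤ if f y ∈ S then 1 / (S.card * c (f y)) else 0 := by
        split_ifs
        exacts [h1, le_rfl]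
      simpa [Real.negMulLog] using h2
    · have hpos : 0 < P y := lt_of_le_of_ne (hP y) (Ne.symm hy)
      have hcy := hcpos y
      rw [if_pos (hS y hy)]
      have h1 := Real.log_le_sub_one_of_pos (x := 1 / (S.card * c (f y)) / P y) (by positivity)
      rw [Real.log_div (by positivity) hy, Real.log_div one_ne_zero (by positivity), Real.log_one,
        Real.log_mul hSpos.ne' hcy.ne'] at h1
      have h2 := mul_le_mul_of_nonneg_left h1 hpos.le
      rw [mul_sub (P y) (_ / _), mul_div_cancel₀ _ hy] at h2
      unfold Real.negMulLog
      linarith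
  have hQ : ∑ y, (if f y ∈ S then 1 / (S.card * c (f y)) else 0) ≤ 1 := by
    rw [← Finset.sum_filter, ← Finset.sum_fiberwise_of_maps_to (t := S) (g := f)
      (fun y hy => (Finset.mem_filter.1 hy).2)]
    calc _ ≤ ∑ _g ∈ S, (1 / S.card : ℝ) := Finset.sum_le_sum fun g hg => ?_
      _ = 1 := by rw [Finset.sum_const, nsmul_eq_mul, mul_one_div_cancel hSpos.ne']
    rw [Finset.filter_filter]
    have h1 : (Finset.univ.filter fun y => f y ∈ S ∧ f y = g) =
        Finset.univ.filter fun y => f y = g := by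
      ext y
      simp only [Finset.mem_filter, Finset.mem_univ, true_and]
      exact ⟨fun h => h.2, fun h => ⟨h ▸ hg, h⟩⟩
    rw [h1, Finset.sum_congr rfl (g := fun _ => 1 / (S.card * c g)) fun y hy => by
      rw [(Finset.mem_filter.1 hy).2], Finset.sum_const, nsmul_eq_mul]
    change c g * _ ≤ _
    rcases eq_or_ne (c g) 0 with h0 | h0
    · rw [h0, zero_mul]
      positivity
    · rw [mul_one_div, mul_comm (S.card : ℝ), div_mul_cancel_left₀ h0, one_div]
  calc ∑ y, Real.negMulLog (P y) ≤ _ := Finset.sum_le_sum fun y _ => hterm y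
    _ = Real.log S.card + ∑ y, P y * Real.log (c (f y)) +
        (∑ y, (if f y ∈ S then 1 / (S.card * c (f y)) else 0) - 1) := by
      rw [Finset.sum_add_distrib, Finset.sum_add_distrib, Finset.sum_sub_distrib, hsum,
        ← Finset.sum_mul, hsum, one_mul]
    _ ≤ _ := by linarith

theorem le_sum_negMulLog (f : β → γ) {K : ℝ} (P : β → ℝ) (hP : ∀ y, 0 ≤ P y)
    (hsum : ∑ y, P y = 1)
    (hK : ∀ y, ((Finset.univ.filter fun y' => f y' = f y).card : ℝ) * P y ≤ K) :
    ∑ y, P y * Real.log (Finset.univ.filter fun y' => f y' = f y).card - Real.log K ≤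
      ∑ y, Real.negMulLog (P y) := by
  have h : Real.log K = ∑ y, P y * Real.log K := by rw [← Finset.sum_mul, hsum, one_mul]
  rw [h, ← Finset.sum_sub_distrib]
  refine Finset.sum_le_sum fun y _ => ?_
  by_cases hy : P y = 0
  · simp [hy]
  have hpos : 0 < P y := lt_of_le_of_ne (hP y) (Ne.symm hy)
  have hc : (0 : ℝ) < (Finset.univ.filter fun y' => f y' = f y).card := by
    exact_mod_cast Finset.card_pos.2 ⟨y, by simp⟩
  have h1 := Real.log_le_log (by positivity) (hK y)
  rw [Real.log_mul hc.ne' hy] at h1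
  have h2 := mul_le_mul_of_nonneg_left h1 hpos.le
  unfold Real.negMulLog
  linarith

/-- The mean log fiber size under the output law is the `p`-average of its means under the laws `W
x`, so it cancels between the two entropies. -/
theorem mutualInfo_le {b : ℝ} (hb : 1 < b) (W : α → β → ℝ) (hW : ∀ x y, 0 ≤ W x y)
    (hsum : ∀ x, ∑ y, W x y = 1) (f : β → γ) (S : Finset γ) (hS : ∀ x y, W x y ≠ 0 → f y ∈ S)
    {K : ℝ} (hK : ∀ x y, ((Finset.univ.filter fun y' => f y' = f y).card : ℝ) * W x y ≤ K)
    {p : α → ℝ} (hp : p ∈ stdSimplex ℝ α) :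
    mutualInfo b W p ≤ Real.logb b S.card + Real.logb b K := by
  have hlog := Real.log_pos hb
  have h1 := sum_negMulLog_le f S (outputLaw W p)
    (fun y => Finset.sum_nonneg fun x _ => mul_nonneg (hp.1 x) (hW x y))
    (by
      unfold outputLaw
      rw [Finset.sum_comm]
      simp only [← Finset.mul_sum, hsum, mul_one]
      exact hp.2)
    (fun y hy => by
      obtain ⟨x, -, hx⟩ := Finset.exists_ne_zero_of_sum_ne_zero hy
      exact hS x y (right_ne_zero_of_mul hx))
  have h2 : ∑ x, p x * (∑ y, W x y * Real.log (Finset.univ.filter fun y' => f y' = f y).card -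
      Real.log K) ≤ ∑ x, p x * ∑ y, Real.negMulLog (W x y) :=
    Finset.sum_le_sum fun x _ => mul_le_mul_of_nonneg_left
      (le_sum_negMulLog f (W x) (hW x) (hsum x) (hK x)) (hp.1 x)
  have h3 : ∑ x, p x * (∑ y, W x y * Real.log (Finset.univ.filter fun y' => f y' = f y).card -
      Real.log K) = ∑ y, outputLaw W p y *
        Real.log (Finset.univ.filter fun y' => f y' = f y).card - Real.log K := by
    simp only [mul_sub, Finset.sum_sub_distrib, ← Finset.sum_mul, hp.2, one_mul, outputLaw,
      Finset.mul_sum]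
    simp only [Finset.sum_mul, mul_assoc]
    rw [Finset.sum_comm]
  unfold mutualInfo entropy Real.logb
  simp only [← mul_div_assoc]
  rw [← Finset.sum_div, ← sub_div, ← add_div]
  exact div_le_div_of_nonneg_right (by linarith) hlog.le

end Information

/-! ### Estimates for Gaussian and shape coefficients. -/

section Bounds

variable {q : ℕ}

theorem pow_le_gaussCoeff (hq : 1 < q) {m k : ℕ} (hk : k ≤ m) :
    (q : ℝ) ^ (k * (m - k)) ≤ gaussCoeff q m k := by
  have hq' : (1 : ℝ) < q := by exact_mod_cast hq
  have h0 : (0 : ℝ) < q := by linarith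
  rw [gaussCoeff, mul_comm, pow_mul]
  conv_lhs => rw [← Finset.card_range k, ← Finset.prod_const, Finset.card_range]
  refine Finset.prod_le_prod (fun i _ => by positivity) fun i hi => ?_
  rw [Finset.mem_range] at hi
  rw [le_div_iff₀ (sub_pos.2 (pow_lt_pow_right₀ hq' hi)), mul_sub, ← pow_add,
    Nat.sub_add_cancel hk, ← pow_add]
  have := pow_le_pow_right₀ hq'.le (Nat.le_add_left i (m - k))
  linarith

theorem quarter_le_prod (k : ℕ) :
    (1 / 4 : ℝ) ≤ ∏ j ∈ Finset.range k, (1 - (1 / 2 : ℝ) ^ (j + 1)) := by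
  rcases k with _ | k
  · norm_num
  -- The bare bound `1/4` is not inductive; the extra term absorbs the loss from each new factor.
  have key : (1 / 4 : ℝ) + (1 / 2) ^ (k + 2) ≤
      ∏ j ∈ Finset.range (k + 1), (1 - (1 / 2 : ℝ) ^ (j + 1)) := by
    induction k with
    | zero => norm_num
    | succ k ih =>
      rw [Finset.prod_range_succ]
      have h1 : (0 : ℝ) < (1 / 2) ^ k := by positivity
      have h2 : ((1 : ℝ) / 2) ^ k ≤ 1 := pow_le_one₀ (by norm_num) (by norm_num)
      refine le_trans ?_ (mul_le_mul_of_nonneg_right ih ?_)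
      · simp only [pow_succ]
        nlinarith
      · rw [sub_nonneg]
        exact pow_le_one₀ (by norm_num) (by norm_num)
  refine le_trans ?_ key
  have : (0 : ℝ) < (1 / 2) ^ (k + 2) := by positivity
  linarith

theorem gaussCoeff_le (hq : 1 < q) {m k : ℕ} (hk : k ≤ m) :
    gaussCoeff q m k ≤ 4 * (q : ℝ) ^ (k * (m - k)) := by
  have hq' : (1 : ℝ) < q := by exact_mod_cast hq
  have hq2 : (2 : ℝ) ≤ q := by exact_mod_cast hq
  have h0 : (0 : ℝ) < q := by linarith
  -- Replace `1/4` by the product of the `1 - 2^(-(k-i))`. Paired factor by factor, the denominators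
  -- are compensated because `q ≥ 2`, leaving at most `q^(m-k)` each.
  have h1 : gaussCoeff q m k * (1 / 4) ≤ (q : ℝ) ^ (k * (m - k)) := by
    refine (mul_le_mul_of_nonneg_left (quarter_le_prod k)
      ((by positivity : (0 : ℝ) ≤ (q : ℝ) ^ (k * (m - k))).trans (pow_le_gaussCoeff hq hk))).trans ?_
    rw [← Finset.prod_range_reflect, gaussCoeff, ← Finset.prod_mul_distrib, mul_comm k, pow_mul]
    conv_rhs => rw [← Finset.card_range k, ← Finset.prod_const, Finset.card_range]
    have hle : ∀ i, i < k → (1 / 2 : ℝ) ^ (k - 1 - i + 1) ≤ 1 := fun i _ =>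
      pow_le_one₀ (by norm_num) (by norm_num)
    refine Finset.prod_le_prod (fun i hi => ?_) fun i hi => ?_
    all_goals
      rw [Finset.mem_range] at hi
      have h2 := sub_pos.2 (pow_lt_pow_right₀ hq' hi)
      have h3 := sub_pos.2 (pow_lt_pow_right₀ hq' (hi.trans_le hk))
    · exact mul_nonneg (div_nonneg h3.le h2.le) (sub_nonneg.2 (hle i hi))
    · rw [div_mul_eq_mul_div, div_le_iff₀ h2]
      have h4 : k - 1 - i + 1 = k - i := by omega
      have h5 : (1 / (q : ℝ)) ^ (k - i) ≤ (1 / 2 : ℝ) ^ (k - i) := by gcongr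
      have h6 : (q : ℝ) ^ m * (1 / (q : ℝ)) ^ (k - i) = (q : ℝ) ^ (m - k) * (q : ℝ) ^ i := by
        rw [one_div, inv_pow, ← div_eq_mul_inv, div_eq_iff (by positivity), ← pow_add, ← pow_add]
        congr 1
        omega
      have h7 : (q : ℝ) ^ m = (q : ℝ) ^ (m - k) * (q : ℝ) ^ k := by
        rw [← pow_add, Nat.sub_add_cancel hk]
      rw [h4, mul_sub ((q : ℝ) ^ (m - k)), ← h6, ← h7]
      have h8 : (0 : ℝ) < (q : ℝ) ^ i := by positivity
      have h9 := hle i hi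
      rw [h4] at h9
      have h10 : (q : ℝ) ^ m * (1 / (q : ℝ)) ^ (k - i) ≤ (q : ℝ) ^ m * (1 / 2 : ℝ) ^ (k - i) := by
        gcongr
      nlinarith [mul_nonneg h8.le (sub_nonneg.2 h9)]
  linarith

variable {s : ℕ} {κ μ : Fin s → ℕ}

theorem shapeCoeff_exponent (hκ : Monotone κ) (hle : κ ≤ μ) (i : Fin s) :
    (μ i - κ i) * comp κ i + (κ i - comp κ i) * (μ i - comp κ i - (κ i - comp κ i)) =
      (μ i - κ i) * κ i := by
  have h1 := comp_le hκ i
  have h2 : μ i - comp κ i - (κ i - comp κ i) = μ i - κ i := by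
    have := hle i
    omega
  rw [h2, mul_comm (κ i - comp κ i), ← mul_add, Nat.add_sub_cancel' h1]

theorem pow_le_shapeCoeff (hq : 1 < q) (hκ : Monotone κ) (hle : κ ≤ μ) :
    (q : ℝ) ^ ∑ i, (μ i - κ i) * κ i ≤ shapeCoeff q μ κ := by
  rw [shapeCoeff, ← Finset.prod_pow_eq_pow_sum]
  refine Finset.prod_le_prod (fun i _ => by positivity) fun i _ => ?_
  rw [← shapeCoeff_exponent hκ hle i, pow_add]
  exact mul_le_mul_of_nonneg_left
    (pow_le_gaussCoeff hq (Nat.sub_le_sub_right (hle i) _)) (by positivity)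

theorem shapeCoeff_pos (hq : 1 < q) (hκ : Monotone κ) (hle : κ ≤ μ) :
    0 < shapeCoeff q μ κ := by
  have : (0 : ℝ) < q := by exact_mod_cast zero_lt_one.trans hq
  exact lt_of_lt_of_le (by positivity) (pow_le_shapeCoeff hq hκ hle)

theorem shapeCoeff_le (hq : 1 < q) (hκ : Monotone κ) (hle : κ ≤ μ) :
    shapeCoeff q μ κ ≤ 4 ^ s * (q : ℝ) ^ ∑ i, (μ i - κ i) * κ i := by
  have h4 : (4 : ℝ) ^ s = ∏ _i : Fin s, 4 := by simp
  rw [shapeCoeff, ← Finset.prod_pow_eq_pow_sum, h4, ← Finset.prod_mul_distrib]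
  have h0 : (0 : ℝ) < q := by exact_mod_cast zero_lt_one.trans hq
  refine Finset.prod_le_prod (fun i _ => mul_nonneg (by positivity) ?_) fun i _ => ?_
  · exact (by positivity : (0 : ℝ) ≤ (q : ℝ) ^ _).trans
      (pow_le_gaussCoeff hq (Nat.sub_le_sub_right (hle i) _))
  · rw [← shapeCoeff_exponent hκ hle i, pow_add, mul_left_comm]
    exact mul_le_mul_of_nonneg_left
      (gaussCoeff_le hq (Nat.sub_le_sub_right (hle i) _)) (by positivity)

theorem zpow_sub_lt_one (hq : 1 < q) {i N : ℕ} (h : i < N) :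
    (q : ℝ) ^ ((i : ℤ) - (N : ℤ)) < 1 :=
  zpow_lt_one_of_neg₀ (by exact_mod_cast hq) (by omega)

theorem prod_one_sub_zpow_pos (hq : 1 < q) {k N : ℕ} (h : k ≤ N) :
    0 < ∏ i ∈ Finset.range k, (1 - (q : ℝ) ^ ((i : ℤ) - (N : ℤ))) :=
  Finset.prod_pos fun _ hi =>
    sub_pos.2 (zpow_sub_lt_one hq ((Finset.mem_range.1 hi).trans_le h))

theorem prod_one_sub_zpow_le_one (hq : 1 < q) {k N : ℕ} (h : k ≤ N) :
    ∏ i ∈ Finset.range k, (1 - (q : ℝ) ^ ((i : ℤ) - (N : ℤ))) ≤ 1 := by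
  refine Finset.prod_le_one (fun i hi => ?_) fun _ _ => ?_
  · exact (sub_pos.2 (zpow_sub_lt_one hq ((Finset.mem_range.1 hi).trans_le h))).le
  · rw [sub_le_self_iff]
    positivity

variable {R : Type*} [CommRing R] [Finite R] {π : R}

theorem card_matricesOfShape_pos (hR : IsFiniteChainRing R π q s) {m : ℕ} (hκ : Monotone κ)
    (hle : ∀ i, κ i ≤ m) {N : ℕ} (hN : ∀ i, κ i ≤ N) :
    0 < Nat.card (matricesOfShape π N m κ) := by
  have hq := hR.one_lt_residue
  have : (0 : ℝ) < q := by exact_mod_cast zero_lt_one.trans hq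
  rw [← Nat.cast_pos (α := ℝ), card_matricesOfShape hR hκ hle hN]
  exact mul_pos (shapeCoeff_pos hq hκ hle)
    (mul_pos (by positivity) (prod_one_sub_zpow_pos hq (comp_le_of_forall_le hN s)))

theorem card_rowMatricesOfShape_pos (hR : IsFiniteChainRing R π q s) (hμ : Monotone μ)
    (hκ : Monotone κ) (hle : κ ≤ μ) {N : ℕ} (hN : ∀ i, κ i ≤ N) :
    0 < Nat.card (rowMatricesOfShape π N μ κ) := by
  have hq := hR.one_lt_residue
  have : (0 : ℝ) < q := by exact_mod_cast zero_lt_one.trans hq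
  rw [← Nat.cast_pos (α := ℝ), card_rowMatricesOfShape hR hμ hκ hle hN]
  exact mul_pos (shapeCoeff_pos hq hκ hle)
    (mul_pos (by positivity) (prod_one_sub_zpow_pos hq (comp_le_of_forall_le hN s)))

end Bounds

/-! ### The channel law and the capacity bound in terms of counts. -/

section Channel

variable {R : Type*} [CommRing R] {π : R} {q s N n : ℕ} {μ τ : Fin s → ℕ}

theorem rowMatrices_iff {X : Matrix (Fin n) (Fin (comp μ s)) R} :
    X ∈ rowMatrices π n μ ↔ rowSpan X ≤ shapeModule π μ := by
  rw [rowSpan, span_le, Set.range_subset_iff]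
  rfl

theorem mul_add_mem_rowMatrices (A : Matrix (Fin N) (Fin n) R)
    {X : Matrix (Fin n) (Fin (comp μ s)) R} (hX : X ∈ rowMatrices π n μ)
    {Z : Matrix (Fin N) (Fin (comp μ s)) R} (hZ : Z ∈ rowMatrices π N μ) :
    A * X + Z ∈ rowMatrices π N μ := fun i =>
  add_mem (rowMatrices_iff.2 ((rowSpan_mul_le A X).trans (rowMatrices_iff.1 hX)) i) (hZ i)

theorem unit_mul_mem_matricesOfShape {κ : Fin s → ℕ} {m : ℕ} {T : Matrix (Fin N) (Fin N) R}
    (hT : IsUnit T) {A : Matrix (Fin N) (Fin m) R} (hA : A ∈ matricesOfShape π N m κ) :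
    T * A ∈ matricesOfShape π N m κ := by
  change HasShape π (rowSpan (T * A)) κ
  rw [rowSpan_unit_mul hT]
  exact hA

theorem mamc_nonneg (X : rowMatrices π n μ) (Y : rowMatrices π N μ) :
    0 ≤ mamc π N n μ τ X Y := by
  unfold mamc
  positivity

variable [Finite R]

theorem sum_mamc (hA : 0 < Nat.card (matricesOfShape π N n (fun _ : Fin s => n)))
    (hZ : 0 < Nat.card (rowMatricesOfShape π N μ τ)) (X : rowMatrices π n μ) :
    ∑ Y, mamc π N n μ τ X Y = 1 := by
  let F : matricesOfShape π N n (fun _ : Fin s => n) × rowMatricesOfShape π N μ τ →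
      rowMatrices π N μ := fun p =>
    ⟨p.1.1 * X.1 + p.2.1, mul_add_mem_rowMatrices p.1.1 X.2 p.2.2.1⟩
  have h : ∀ Y : rowMatrices π N μ,
      Nat.card {p : matricesOfShape π N n (fun _ : Fin s => n) × rowMatricesOfShape π N μ τ //
        p.1.1 * X.1 + p.2.1 = Y.1} = Nat.card {p // F p = Y} := fun Y =>
    Nat.card_congr (Equiv.subtypeEquivRight fun p =>
      ⟨fun h => Subtype.ext h, fun h => congrArg Subtype.val h⟩)
  unfold mamc
  rw [← Finset.sum_div, ← Nat.cast_sum, Finset.sum_congr rfl fun Y _ => h Y, ← Nat.card_sigma,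
    Nat.card_congr (Equiv.sigmaFiberEquiv F), Nat.card_prod, Nat.cast_mul]
  exact div_self (by positivity)

/-- Given `X` and `Y`, the noise `Z = Y - A X` is determined by `A`. -/
theorem mamc_le (X : rowMatrices π n μ) (Y : rowMatrices π N μ) :
    mamc π N n μ τ X Y ≤
      (Nat.card {A : matricesOfShape π N n (fun _ : Fin s => n) //
        HasShape π (rowSpan (Y.1 - A.1 * X.1)) τ} : ℝ) /
      ((Nat.card (matricesOfShape π N n (fun _ : Fin s => n)) : ℝ) *
        (Nat.card (rowMatricesOfShape π N μ τ) : ℝ)) := by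
  unfold mamc
  refine div_le_div_of_nonneg_right (Nat.cast_le.2 ?_) (by positivity)
  refine Nat.card_le_card_of_injective (fun p => ⟨p.1.1, ?_⟩) fun p p' h => ?_
  · rw [sub_eq_of_eq_add' p.2.symm]
    exact p.1.2.2.2
  · have h1 : p.1.1 = p'.1.1 := congrArg Subtype.val h
    refine Subtype.ext (Prod.ext h1 (Subtype.ext ?_))
    have h2 := p.2.trans p'.2.symm
    rw [h1] at h2
    exact add_left_cancel h2

theorem capacity_mamc_le (hR : IsFiniteChainRing R π q s) (hn : n ≤ N) (hμ : Monotone μ)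
    (hτ : Monotone τ) (hτN : ∀ i, τ i ≤ N) (hτμ : τ ≤ μ) :
    capacity q (mamc π N n μ τ) ≤
      Real.logb q (∑ κ ∈ (subshapes μ).filter (fun κ => ∀ i, κ i ≤ N ∧ κ i ≤ n + τ i),
          shapeCoeff q μ κ)
        - Real.logb q (Nat.card (rowMatricesOfShape π N μ τ))
        + Real.logb q (∑ τ' ∈ subshapes τ,
            (Nat.card (matricesOfShape π N (min (n + comp τ s) N) τ') : ℝ)) := by
  classical
  have hq := hR.one_lt_residue
  have hq' : (1 : ℝ) < q := by exact_mod_cast hq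
  have hL := hasSocleType_shapeModule hR hμ
  have hA : 0 < Nat.card (matricesOfShape π N n (fun _ : Fin s => n)) :=
    card_matricesOfShape_pos hR monotone_const (fun _ => le_rfl) fun _ => hn
  have hZ : 0 < Nat.card (rowMatricesOfShape π N μ τ) :=
    card_rowMatricesOfShape_pos hR hμ hτ hτμ hτN
  set T := (subshapes μ).filter (fun κ => ∀ i, κ i ≤ N ∧ κ i ≤ n + τ i) with hT
  set m' := min (n + comp τ s) N with hm'
  set K := ∑ τ' ∈ subshapes τ, Nat.card (matricesOfShape π N m' τ') with hK
  have hKpos : 0 < K := by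
    refine (card_matricesOfShape_pos hR hτ (fun i => ?_) hτN).trans_le
      (Finset.single_le_sum (f := fun τ' => Nat.card (matricesOfShape π N m' τ'))
        (fun _ _ => Nat.zero_le _) (by simp [subshapes, hτ]))
    exact le_min ((le_comp hτ i).trans (Nat.le_add_left _ _)) (hτN i)
  let _ : Fintype (Submodule R (shapeModule π μ)) :=
    @Fintype.ofFinite _ (Finite.of_injective _ SetLike.coe_injective)
  -- The row span is viewed inside `R^μ` rather than the ambient free module, so that `shapeCoeff q
  -- μ` counts its possible values.
  let f : rowMatrices π N μ → Submodule R (shapeModule π μ) := fun Y =>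
    span R (Set.range fun i => (⟨Y.1 i, Y.2 i⟩ : shapeModule π μ))
  have hmap : ∀ Y, rowSpan Y.1 = (f Y).map (shapeModule π μ).subtype := fun Y => by
    rw [rowSpan, Submodule.map_span, ← Set.range_comp]
    rfl
  let S : Finset (Submodule R (shapeModule π μ)) :=
    T.biUnion fun κ => Finset.univ.filter fun U => HasShape π U κ
  have hScard : (S.card : ℝ) ≤ ∑ κ ∈ T, shapeCoeff q μ κ := by
    refine (Nat.cast_le.2 Finset.card_biUnion_le).trans ?_
    rw [Nat.cast_sum]
    refine Finset.sum_le_sum fun κ hκ => ?_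
    simp only [hT, subshapes, Finset.mem_filter, Finset.mem_Iic] at hκ
    rw [← card_submodules_of_shape hR hL hκ.1.2 hκ.1.1, Nat.card_eq_fintype_card,
      Fintype.card_subtype]
  have hS : ∀ X Y, mamc π N n μ τ X Y ≠ 0 → f Y ∈ S := by
    intro X Y hXY
    have h1 : Nat.card {p : matricesOfShape π N n (fun _ : Fin s => n) ×
        rowMatricesOfShape π N μ τ // p.1.1 * X.1 + p.2.1 = Y.1} ≠ 0 := by
      intro h0
      refine hXY ?_
      unfold mamc
      rw [h0, Nat.cast_zero, zero_div]
    obtain ⟨⟨⟨⟨A, _hA⟩, ⟨Z, hZ⟩⟩, hp⟩⟩ := (Nat.card_ne_zero.1 h1).1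
    dsimp only at hp
    obtain ⟨ν, hmono, hν⟩ := exists_hasSocleType hR (f Y)
    have hν' : HasSocleType π q (rowSpan Y.1) ν := by
      rw [hmap]
      exact hν.congr (equivMapOfInjective _ (injective_subtype _) _)
    have hτZ : HasSocleType π q (rowSpan (Y.1 - A * X.1)) τ := by
      rw [← hp, add_sub_cancel_left]
      exact ((hasShape_iff hR).1 hZ.2).2
    simp only [S, hT, subshapes, Finset.mem_biUnion, Finset.mem_filter, Finset.mem_Iic,
      Finset.mem_univ, true_and]
    exact ⟨ν, ⟨⟨hν.le_of_injective hR hL _ (injective_subtype _), hmono⟩, fun i =>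
      ⟨hν'.le_of_rowSpan hR i, hν'.le_add_of_rowSpan hR A X.1 hτZ i⟩⟩,
      (hasShape_iff hR).2 ⟨hmono, hν⟩⟩
  have hfiber : ∀ X Y, ((Finset.univ.filter fun Y' => f Y' = f Y).card : ℝ) *
      mamc π N n μ τ X Y ≤ K / Nat.card (rowMatricesOfShape π N μ τ) := by
    intro X Y
    have h1 : (Finset.univ.filter fun Y' => f Y' = f Y).card ≤
        Nat.card {Y' : Matrix (Fin N) (Fin (comp μ s)) R // rowSpan Y' = rowSpan Y.1} := by
      rw [← Fintype.card_subtype, ← Nat.card_eq_fintype_card]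
      let G : {Y' // f Y' = f Y} →
          {Y' : Matrix (Fin N) (Fin (comp μ s)) R // rowSpan Y' = rowSpan Y.1} := fun Y' =>
        ⟨Y'.1.1, by rw [hmap, hmap, Y'.2]⟩
      refine Nat.card_le_card_of_injective G fun Y' Y'' h => ?_
      have h0 : (G Y').1 = (G Y'').1 := by rw [h]
      exact Subtype.ext (Subtype.ext h0)
    have h2 := card_rowSpan_mul_card_le hR (τ := τ) (m' := m') X.1
      (matricesOfShape π N n (fun _ : Fin s => n))
      (fun T hT A hA => unit_mul_mem_matricesOfShape hT hA)
      (fun i => by have := le_comp hτ i; omega) Y.1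
    have h3 := (Nat.mul_le_mul_right _ h1).trans h2
    refine (mul_le_mul_of_nonneg_left (mamc_le X Y) (by positivity)).trans ?_
    rw [← mul_div_assoc, div_le_div_iff₀ (by positivity) (by positivity)]
    have h4 : (((Finset.univ.filter fun Y' => f Y' = f Y).card : ℝ) *
        Nat.card {A : matricesOfShape π N n (fun _ : Fin s => n) //
          HasShape π (rowSpan (Y.1 - A.1 * X.1)) τ}) ≤
        Nat.card (matricesOfShape π N n (fun _ : Fin s => n)) * K := by
      exact_mod_cast h3
    calc _ ≤ (Nat.card (matricesOfShape π N n (fun _ : Fin s => n)) * K : ℝ) *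
          Nat.card (rowMatricesOfShape π N μ τ) := by gcongr
      _ = _ := by ring
  have hsum := sum_mamc (μ := μ) (τ := τ) hA hZ
  have : Nonempty (rowMatrices π n μ) := ⟨⟨0, fun _ => zero_mem _⟩⟩
  obtain ⟨p, hp, hcap⟩ := (capacity_isGreatest (q : ℝ) (mamc π N n μ τ)).1
  have hmain := mutualInfo_le hq' (mamc π N n μ τ) mamc_nonneg hsum f S hS hfiber hp
  have hSpos : (0 : ℝ) < S.card := by
    obtain ⟨X⟩ := this
    obtain ⟨Y, -, hY⟩ := Finset.exists_ne_zero_of_sum_ne_zero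
      (by rw [hsum X]; exact one_ne_zero : ∑ Y, mamc π N n μ τ X Y ≠ 0)
    exact_mod_cast Finset.card_pos.2 ⟨_, hS X Y hY⟩
  rw [hcap, Real.logb_div (by positivity) (by positivity)] at hmain
  have h5 := Real.logb_le_logb_of_le hq' hSpos hScard
  have h6 : ∑ τ' ∈ subshapes τ, (Nat.card (matricesOfShape π N m' τ') : ℝ) = K := by
    rw [hK, Nat.cast_sum]
  rw [h6]
  linarith

end Channel

/-! ### Explicit bounds. -/

section ExplicitBounds

variable {s : ℕ}

/-- Adding `i` to the entry at `i` makes `κ` strictly increasing, hence encodes it as an `s`-subset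
of `{0, …, k + s - 1}`. -/
theorem card_le_choose_of_monotone (T : Finset (Fin s → ℕ)) {k : ℕ}
    (hT : ∀ κ ∈ T, Monotone κ ∧ ∀ i, κ i ≤ k) : T.card ≤ (k + s).choose s := by
  classical
  have hmono : ∀ κ ∈ T, StrictMono fun i : Fin s => κ i + i := fun κ hκ =>
    (hT κ hκ).1.add_strictMono Fin.val_strictMono
  rw [← Finset.card_range (k + s), ← Finset.card_powersetCard]
  refine Finset.card_le_card_of_injOn (fun κ => Finset.univ.image fun i : Fin s => κ i + i) ?_ ?_
  · intro κ hκ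
    rw [Finset.mem_coe, Finset.mem_powersetCard, Finset.card_image_of_injective _
      (hmono κ hκ).injective, Finset.card_univ, Fintype.card_fin]
    refine ⟨fun x hx => ?_, rfl⟩
    obtain ⟨i, -, rfl⟩ := Finset.mem_image.1 hx
    have := (hT κ hκ).2 i
    have := i.2
    rw [Finset.mem_range]
    omega
  · intro κ hκ κ' hκ' h
    have h1 : Set.range (fun i : Fin s => κ i + i) = Set.range fun i : Fin s => κ' i + i := by
      have := congrArg (fun F : Finset ℕ => (F : Set ℕ)) h
      simpa using this
    have h2 := ((hmono κ hκ).range_inj (hmono κ' hκ')).1 h1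
    funext i
    have := congrFun h2 i
    omega

/-- The parabola `k (m - k)` rises up to `m / 2`, so under the cap `c` it is largest at `x`. The
difference of the two sides is `(x - k)(m - x - k)`; if `k` exceeds `x`, then `x` is the rounded
half and both factors are nonpositive. -/
theorem sub_mul_le_of_le_half {m k x c : ℕ} (hx : x = min c (m / 2)) (hkc : k ≤ c) (hkm : k ≤ m) :
    (m - k) * k ≤ (m - x) * x := by
  have hxm : 2 * x ≤ m := by omega
  have h : x < k → m ≤ x + k := by omega
  zify [hkm, (by omega : x ≤ m)]
  rcases le_or_gt k x with h1 | h1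
  · have h1' : (k : ℤ) ≤ x := by exact_mod_cast h1
    have h2' : (2 * x : ℤ) ≤ m := by exact_mod_cast hxm
    nlinarith [mul_nonneg (sub_nonneg.2 h1') (by linarith : (0 : ℤ) ≤ m - x - k)]
  · have h2' : (m : ℤ) ≤ x + k := by exact_mod_cast h h1
    have h1' : (x : ℤ) ≤ k := by exact_mod_cast h1.le
    nlinarith [mul_nonneg (sub_nonneg.2 h1') (sub_nonneg.2 h2')]

theorem mul_add_sub_mul_le {N M k t : ℕ} (hkt : k ≤ t) (htN : t ≤ N) (htM : t ≤ M) :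
    N * k + (M - k) * k ≤ N * t + (M - t) * t := by
  zify [hkt.trans htM, htM]
  have h1 : (k : ℤ) ≤ t := by exact_mod_cast hkt
  have h2 : (t : ℤ) ≤ N := by exact_mod_cast htN
  have h3 : (t : ℤ) ≤ M := by exact_mod_cast htM
  nlinarith [mul_nonneg (sub_nonneg.2 h1) (by linarith : (0 : ℤ) ≤ N + M - t - k)]

theorem logb_sum_le {ι : Type*} {q : ℕ} (hq : 1 < q) (T : Finset ι) (g : ι → ℝ)
    (hpos : 0 < ∑ i ∈ T, g i) {c e : ℕ} (hT : T.card ≤ c)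
    (hg : ∀ i ∈ T, g i ≤ 4 ^ s * (q : ℝ) ^ e) :
    Real.logb q (∑ i ∈ T, g i) ≤ Real.logb q c + s * Real.logb q 4 + e := by
  have hq' : (1 : ℝ) < q := by exact_mod_cast hq
  have h0 : (0 : ℝ) < q := by linarith
  have h1 : ∑ i ∈ T, g i ≤ c * (4 ^ s * (q : ℝ) ^ e) := by
    refine (Finset.sum_le_card_nsmul T g _ hg).trans ?_
    rw [nsmul_eq_mul]
    gcongr
  have hc : c ≠ 0 := by
    rintro rfl
    rw [Nat.cast_zero, zero_mul] at h1
    linarith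
  have h2 := Real.logb_le_logb_of_le hq' hpos h1
  rwa [Real.logb_mul (by positivity) (by positivity), Real.logb_mul (by positivity) (by positivity),
    Real.logb_pow, Real.logb_pow, Real.logb_self_eq_one hq', mul_one, ← add_assoc] at h2

variable {R : Type*} [CommRing R] [Finite R] {π : R} {q N n : ℕ} {μ τ : Fin s → ℕ}

theorem le_logb_card_rowMatricesOfShape (hR : IsFiniteChainRing R π q s) (hμ : Monotone μ)
    (hτ : Monotone τ) (hτN : ∀ i, τ i ≤ N) (hτμ : τ ≤ μ) :
    ((N * ∑ i, τ i + ∑ i, (μ i - τ i) * τ i : ℕ) : ℝ) +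
      Real.logb q (∏ i ∈ Finset.range (comp τ s), (1 - (q : ℝ) ^ ((i : ℤ) - (N : ℤ)))) ≤
      Real.logb q (Nat.card (rowMatricesOfShape π N μ τ)) := by
  have hq := hR.one_lt_residue
  have hq' : (1 : ℝ) < q := by exact_mod_cast hq
  have h0 : (0 : ℝ) < q := by linarith
  have hprod := prod_one_sub_zpow_pos hq (comp_le_of_forall_le hτN s)
  have h1 := Real.logb_le_logb_of_le hq' (by positivity) (pow_le_shapeCoeff hq hτ hτμ)
  rw [card_rowMatricesOfShape hR hμ hτ hτμ hτN, Real.logb_mul (shapeCoeff_pos hq hτ hτμ).ne'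
    (by positivity), Real.logb_mul (by positivity) hprod.ne', Real.logb_pow,
    Real.logb_self_eq_one hq', mul_one]
  rw [Real.logb_pow, Real.logb_self_eq_one hq', mul_one] at h1
  rw [Nat.cast_add]
  linarith

theorem capacity_mamc_le_explicit (hR : IsFiniteChainRing R π q s) (hn : n ≤ N) (hμ : Monotone μ)
    (hτ : Monotone τ) (hτN : ∀ i, τ i ≤ N) (hτμ : τ ≤ μ) {ξ : Fin s → ℕ}
    (hξ : ∀ i, ξ i = min N (min (n + τ i) (μ i / 2))) :
    capacity q (mamc π N n μ τ) ≤
        ∑ i, ((μ i : ℝ) - ξ i) * ξ i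
          + ∑ i, (((min (n + comp τ s) N : ℕ) : ℝ) - μ i) * τ i
          + 2 * s * Real.logb q 4
          + Real.logb q ((N + s).choose s)
          + Real.logb q ((comp τ s + s).choose s)
          - Real.logb q (∏ i ∈ Finset.range (comp τ s), (1 - (q : ℝ) ^ ((i : ℤ) - (N : ℤ)))) := by
  have hq := hR.one_lt_residue
  have hq' : (1 : ℝ) < q := by exact_mod_cast hq
  have h0 : (0 : ℝ) < q := by linarith
  set M := min (n + comp τ s) N with hM
  have hτM : ∀ i, τ i ≤ M := fun i => le_min ((le_comp hτ i).trans (Nat.le_add_left _ _)) (hτN i)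
  have ha := capacity_mamc_le (n := n) hR hn hμ hτ hτN hτμ
  have hb := le_logb_card_rowMatricesOfShape hR hμ hτ hτN hτμ
  have hc : Real.logb q (∑ κ ∈ (subshapes μ).filter (fun κ => ∀ i, κ i ≤ N ∧ κ i ≤ n + τ i),
      shapeCoeff q μ κ) ≤ Real.logb q ((N + s).choose s) + s * Real.logb q 4 +
      (∑ i, (μ i - ξ i) * ξ i : ℕ) := by
    have hmem : ∀ κ ∈ (subshapes μ).filter (fun κ => ∀ i, κ i ≤ N ∧ κ i ≤ n + τ i),
        κ ≤ μ ∧ Monotone κ ∧ ∀ i, κ i ≤ N ∧ κ i ≤ n + τ i := fun κ hκ => by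
      simpa [subshapes, and_assoc] using hκ
    refine logb_sum_le hq _ _ (Finset.sum_pos (fun κ hκ => ?_) ⟨0, ?_⟩) ?_ fun κ hκ => ?_
    · exact shapeCoeff_pos hq (hmem κ hκ).2.1 (hmem κ hκ).1
    · exact Finset.mem_filter.2 ⟨Finset.mem_filter.2 ⟨Finset.mem_Iic.2 fun i => Nat.zero_le _,
        monotone_const⟩, fun i => ⟨Nat.zero_le _, Nat.zero_le _⟩⟩
    · exact card_le_choose_of_monotone _ fun κ hκ => ⟨(hmem κ hκ).2.1, fun i =>
        ((hmem κ hκ).2.2 i).1⟩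
    · refine (shapeCoeff_le hq (hmem κ hκ).2.1 (hmem κ hκ).1).trans ?_
      obtain ⟨h1, -, h2⟩ := hmem κ hκ
      refine mul_le_mul_of_nonneg_left (pow_le_pow_right₀ hq'.le
        (Finset.sum_le_sum fun i _ => ?_)) (by positivity)
      exact sub_mul_le_of_le_half (c := min N (n + τ i)) (by rw [hξ, min_assoc])
        (le_min (h2 i).1 (h2 i).2) (h1 i)
  have hd : Real.logb q (∑ τ' ∈ subshapes τ, (Nat.card (matricesOfShape π N M τ') : ℝ)) ≤
      Real.logb q ((comp τ s + s).choose s) + s * Real.logb q 4 +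
      (∑ i, (N * τ i + (M - τ i) * τ i) : ℕ) := by
    have hmem : ∀ κ ∈ subshapes τ, κ ≤ τ ∧ Monotone κ := fun κ hκ => by
      simpa [subshapes] using hκ
    refine logb_sum_le hq _ _ (Finset.sum_pos (fun κ hκ => ?_) ⟨τ, ?_⟩) ?_ fun κ hκ => ?_
    · obtain ⟨h1, h2⟩ := hmem κ hκ
      exact Nat.cast_pos.2 (card_matricesOfShape_pos hR h2 (fun i => (h1 i).trans (hτM i))
        fun i => (h1 i).trans (hτN i))
    · simpa [subshapes] using hτ
    · exact card_le_choose_of_monotone _ fun κ hκ => ⟨(hmem κ hκ).2, fun i =>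
        ((hmem κ hκ).1 i).trans (le_comp hτ i)⟩
    · obtain ⟨h1, h2⟩ := hmem κ hκ
      have hκM : ∀ i, κ i ≤ M := fun i => (h1 i).trans (hτM i)
      have hκN : ∀ i, κ i ≤ N := fun i => (h1 i).trans (hτN i)
      rw [card_matricesOfShape hR h2 hκM hκN]
      have h3 := shapeCoeff_le hq h2 (μ := fun _ => M) hκM
      have h4 := prod_one_sub_zpow_le_one hq (comp_le_of_forall_le hκN s)
      calc _ ≤ (4 ^ s * (q : ℝ) ^ ∑ i, (M - κ i) * κ i) * ((q : ℝ) ^ (N * ∑ i, κ i) * 1) := by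
            refine mul_le_mul h3 (by gcongr) ?_ (by positivity)
            exact mul_nonneg (by positivity)
              (prod_one_sub_zpow_pos hq (comp_le_of_forall_le hκN s)).le
        _ = 4 ^ s * (q : ℝ) ^ ∑ i, (N * κ i + (M - κ i) * κ i) := by
            rw [mul_one, mul_assoc, ← pow_add, Finset.sum_add_distrib, ← Finset.mul_sum, add_comm]
        _ ≤ _ := mul_le_mul_of_nonneg_left (pow_le_pow_right₀ hq'.le (Finset.sum_le_sum fun i _ =>
            mul_add_sub_mul_le (h1 i) (hτN i) (hτM i))) (by positivity)
  have he : ((∑ i, (μ i - ξ i) * ξ i : ℕ) : ℝ) = ∑ i, ((μ i : ℝ) - ξ i) * ξ i := by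
    rw [Nat.cast_sum]
    refine Finset.sum_congr rfl fun i _ => ?_
    rw [Nat.cast_mul, Nat.cast_sub (by rw [hξ]; omega)]
  -- The terms `N τ_i` and `τ_i²` from the projected noise count and from the noise count cancel.
  have hf : ((∑ i, (N * τ i + (M - τ i) * τ i) : ℕ) : ℝ) -
      ((N * ∑ i, τ i + ∑ i, (μ i - τ i) * τ i : ℕ) : ℝ) = ∑ i, ((M : ℝ) - μ i) * τ i := by
    rw [Finset.mul_sum, ← Finset.sum_add_distrib, Nat.cast_sum, Nat.cast_sum,
      ← Finset.sum_sub_distrib]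
    refine Finset.sum_congr rfl fun i _ => ?_
    have h1 : τ i ≤ μ i := hτμ i
    push_cast [Nat.cast_sub (hτM i), Nat.cast_sub h1]
    ring
  linarith

end ExplicitBounds

end MatrixChannel
end

open MatrixChannel
theorem mainTheorem11 {R : Type*} [CommRing R] [Finite R] (π : R) (q s : ℕ)
    (hR : IsFiniteChainRing R π q s) (N n : ℕ) (hn : n ≤ N)
    (μ τ : Fin s → ℕ) (hμ : Monotone μ) (hτ : Monotone τ)
    (hτN : ∀ i, τ i ≤ N) (hτμ : τ ≤ μ) :
    (capacity q (mamc π N n μ τ) ≤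
      Real.logb q (∑ κ ∈ (subshapes μ).filter (fun κ => ∀ i, κ i ≤ N ∧ κ i ≤ n + τ i),
          shapeCoeff q μ κ)
        - Real.logb q (Nat.card (rowMatricesOfShape π N μ τ))
        + Real.logb q (∑ τ' ∈ subshapes τ,
            (Nat.card (matricesOfShape π N (min (n + comp τ s) N) τ') : ℝ))) ∧
    (∀ ξ : Fin s → ℕ, (∀ i, ξ i = min N (min (n + τ i) (μ i / 2))) →
      capacity q (mamc π N n μ τ) ≤
        ∑ i, ((μ i : ℝ) - ξ i) * ξ i
          + ∑ i, (((min (n + comp τ s) N : ℕ) : ℝ) - μ i) * τ i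
          + 2 * s * Real.logb q 4
          + Real.logb q ((N + s).choose s)
          + Real.logb q ((comp τ s + s).choose s)
          - Real.logb q (∏ i ∈ Finset.range (comp τ s), (1 - (q : ℝ) ^ ((i : ℤ) - (N : ℤ))))) ∧
    (∀ t : ℕ, (∀ i, τ i = t) → (∀ i, 2 * N ≤ μ i) →
      capacity q (mamc π N n μ τ) ≤
        ∑ i, (((min (n + t) N : ℕ) : ℝ) - t) * ((μ i : ℝ) - (min (n + t) N : ℕ))
          + 2 * s * Real.logb q 4
          + Real.logb q ((N + s).choose s)
          + Real.logb q ((t + s).choose s)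
          - Real.logb q (∏ i ∈ Finset.range t, (1 - (q : ℝ) ^ ((i : ℤ) - (N : ℤ))))) := by
  refine ⟨capacity_mamc_le hR hn hμ hτ hτN hτμ, fun ξ hξ =>
    capacity_mamc_le_explicit hR hn hμ hτ hτN hτμ hξ, fun t ht hμN => ?_⟩
  have hs := hR.length_pos
  have hcomp : comp τ s = t := by
    rw [comp, dif_pos ⟨hs, le_rfl⟩, ht]
  -- As `μ_i / 2 ≥ N`, the half of `μ_i` never attains the minimum strictly, so `ξ` is constant.
  -- With `M` for this constant, the two sums merge by `(μ_i - M) M + (M - μ_i) t = (M - t)(μ_i -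
  -- M)`.
  have h := capacity_mamc_le_explicit (n := n) hR hn hμ hτ hτN hτμ (ξ := fun _ => min (n + t) N)
    fun i => by
      have := hμN i
      rw [ht i]
      omega
  rw [hcomp] at h
  refine h.trans_eq ?_
  rw [← Finset.sum_add_distrib]
  congr 4
  refine Finset.sum_congr rfl fun i _ => ?_
  rw [ht i]
  ring
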